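/- **Setting.** Let $k$ be a field, $Q$ a finite quiver with path algebra $kQ$ (paths are concatenated from left to right), $J\subseteq kQ$ the ideal generated by the arrows, and $I\subseteq J^2$ a two-sided ideal that is homogeneous for path length, such that $\Lambda=kQ/I$ is a Koszul algebra. An element of $kQ$ is *uniform* if it is nonzero and is a linear combination of paths that have the same length, the same origin and the same terminus; its origin $o(f)$ and terminus $t(f)$ are identified with vertex idempotents. For each $n\ge 0$ let $f^n_i$, $i=0,\dots,t_n$, be finitely many uniform elements of $kQ$ (possibly none for a given $n$), where the $f^0_i$ are the vertices and the $f^1_i$ are the arrows, such that the sums $\sum_i f^n_i kQ$ are direct, $\bigoplus_i f^{n+1}_i kQ\subseteq\bigoplus_i f^n_i kQ$, and the right modules $L_n=\bigoplus_i f^n_i kQ/\bigoplus_i f^n_i I$, with the maps induced by these inclusions, form a minimal projective resolution of $\Lambda_0=kQ/J$ over $\Lambda$. Let $c_{pq}(n,i,r)\in k$ be scalars such that for all $n$, $i$ and $0\le r\le n$ $$f^n_i=\sum_{p}\sum_{q}c_{pq}(n,i,r)\,f^r_p f^{n-r}_q .$$ Let $\mathbb K_n=\bigoplus_i \Lambda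 o(f^n_i)\otimes_k t(f^n_i)\Lambda$ with the elements $\varepsilon^n_i=(0,\dots,0,o(f^n_i)\otimes t(f^n_i),0,\dots,0)$. Let $d$, the augmentation $\mu:\mathbb K_0\to\Lambda$ and the diagonal map $\Delta_{\mathbb K}:\mathbb K\to\mathbb K\otimes_\Lambda\mathbb K$ be the maps of bimodules with $d(\varepsilon^0_i)=0$, $\mu(\varepsilon^0_i)=f^0_i$ and $$d(\varepsilon^n_i)=\sum_{j}\Big(\sum_{p}c_{pj}(n,i,1)f^1_p\varepsilon^{n-1}_j+(-1)^n\sum_{q}c_{jq}(n,i,n-1)\varepsilon^{n-1}_jf^1_q\Big)\quad(n\ge1),$$ $$\Delta_{\mathbb K}(\varepsilon^n_i)=\sum_{r=0}^n\sum_{p}\sum_{q}c_{pq}(n,i,r)\,\varepsilon^r_p\otimes_\Lambda\varepsilon^{n-r}_q .$$ A *homotopy lifting* of a cocycle $\eta\in\mathrm{Hom}_{\Lambda^e}(\mathbb K_n,\Lambda)$ with respect to $\Delta_{\mathbb K}$ is a family of maps of bimodules $\psi_\eta:\mathbb K_m\to\mathbb K_{m-n+1}$ such that $$d\psi_\eta-(-1)^{n-1}\psi_\eta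 d=(\eta\otimes 1-1\otimes\eta)\Delta_{\mathbb K},$$ where $(1\otimes\eta)(x\otimes y)=(-1)^{n|x|}x\,\eta(y)$, and such that for some maps of bimodules $\psi:\mathbb K_m\to\mathbb K_{m+1}$ with $d\psi+\psi d=(\mu\otimes1-1\otimes\mu)\Delta_{\mathbb K}$ the cochains $\mu\psi_\eta$ and $(-1)^{n-1}\eta\psi$ on $\mathbb K_{n-1}$ differ by a coboundary. **Corollary.** Let $n\ge 0$ and let $\eta:\mathbb K_n\to\Lambda$ be a cocycle such that for some $i$ and some vertex idempotent $e_j$ one has $\eta(\varepsilon^n_i)=e_j$, and $\eta(\varepsilon^n_r)=0$ for all $r\ne i$. Then all homotopy lifting maps associated to $\eta$ can be taken to be zero: the maps $\psi_\eta=0:\mathbb K_m\to\mathbb K_{m-n+1}$, for all $m$, form a homotopy lifting of $\eta$ with respect to $\Delta_{\mathbb K}$. -/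

import Mathlib

open scoped TensorProduct
open MulOpposite

universe u v w

set_option linter.unusedSectionVars false

noncomputable section

/-! ## Path algebras -/

/-- A path of a quiver `V`, together with its origin and its terminus.  The trivial paths are the
vertices; paths are concatenated from left to right. -/
structure QPath (V : Type v) [Quiver.{w} V] where
  src : V
  tgt : V
  path : Quiver.Path src tgt

/-- The path algebra `kQ`: the vector space with basis all paths. -/
def PathAlgebra (k : Type u) (V : Type v) [Quiver.{w} V] [Field k] : Type (max u v w) :=
  QPath V →₀ k

namespace PathAlgebra

variable (k : Type u) {V : Type v} [Quiver.{w} V] [Field k]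

instance : AddCommGroup (PathAlgebra k V) := inferInstanceAs (AddCommGroup (QPath V →₀ k))

instance : Module k (PathAlgebra k V) := inferInstanceAs (Module k (QPath V →₀ k))

/-- The basis of `kQ` consisting of all paths. -/
def basis : Module.Basis (QPath V) k (PathAlgebra k V) :=
  Module.Basis.ofRepr (LinearEquiv.refl k (QPath V →₀ k))

/-- The basis element given by a path. -/
def ofPath (p : QPath V) : PathAlgebra k V := basis k p

/-- The coefficient of a path in an element of the path algebra. -/
def coeff {k : Type u} [Field k] (x : PathAlgebra k V) (p : QPath V) : k := (basis k).repr x p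

open Classical in
/-- The product of two paths: their concatenation if they are composable, and `0` otherwise. -/
def mulPath (p q : QPath V) : PathAlgebra k V :=
  if h : p.tgt = q.src then ofPath k ⟨p.src, q.tgt, p.path.comp (q.path.cast h.symm rfl)⟩ else 0

/-- The multiplication of `kQ`, extended bilinearly from paths. -/
def mulHom : PathAlgebra k V →ₗ[k] PathAlgebra k V →ₗ[k] PathAlgebra k V :=
  (basis k).constr k fun p => (basis k).constr k fun q => mulPath k p q

instance : Mul (PathAlgebra k V) := ⟨fun x y => mulHom k x y⟩

/-- The idempotent `e_a` of a vertex `a`. -/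
def vertex (a : V) : PathAlgebra k V := ofPath k ⟨a, a, Quiver.Path.nil⟩

/-- An arrow, regarded as an element of `kQ`. -/
def arrow {a b : V} (α : a ⟶ b) : PathAlgebra k V := ofPath k ⟨a, b, α.toPath⟩

instance [Fintype V] : One (PathAlgebra k V) := ⟨∑ a : V, vertex k a⟩

variable {k}

theorem induction {P : PathAlgebra k V → Prop} (x : PathAlgebra k V) (h0 : P 0)
    (hadd : ∀ x y, P x → P y → P (x + y)) (hp : ∀ p (c : k), P (c • ofPath k p)) : P x := by
  rw [← (basis k).linearCombination_repr x]
  refine Finsupp.induction_linear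
    (motive := fun y => P (Finsupp.linearCombination k (basis k) y)) _ (by simpa using h0)
    (fun y z hy hz => by simpa using hadd _ _ hy hz) fun p c => by simpa [ofPath] using hp p c

theorem mul_def (x y : PathAlgebra k V) : x * y = mulHom k x y := rfl

theorem ofPath_mul (p q : QPath V) : ofPath k p * ofPath k q = mulPath k p q := by
  simp [mul_def, mulHom, ofPath]

theorem ofPath_mul_assoc (p q r : QPath V) :
    ofPath k p * ofPath k q * ofPath k r = ofPath k p * (ofPath k q * ofPath k r) := by
  obtain ⟨a, b, p⟩ := p
  obtain ⟨c, d, q⟩ := q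
  obtain ⟨e, f, r⟩ := r
  rw [ofPath_mul, ofPath_mul]
  by_cases h : b = c
  · subst h
    by_cases h' : d = e
    · subst h'
      simp [mulPath, ofPath_mul, Quiver.Path.comp_assoc]
    · have := ofPath_mul (k := k) ⟨a, d, p.comp q⟩ ⟨e, f, r⟩
      simp only [mulPath, h', dite_false, mul_def] at this
      simp [mulPath, h', mul_def, this]
  · by_cases h' : d = e
    · subst h'
      have := ofPath_mul (k := k) ⟨a, b, p⟩ ⟨c, f, q.comp r⟩
      simp only [mulPath, h, dite_false, mul_def] at this
      simp [mulPath, h, mul_def, this]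
    · simp [mulPath, h, h', mul_def]

theorem vertex_mul_ofPath [DecidableEq V] (a : V) (p : QPath V) :
    vertex k a * ofPath k p = if a = p.src then ofPath k p else 0 := by
  obtain ⟨b, c, p⟩ := p
  rw [vertex, ofPath_mul]
  by_cases h : a = b
  · subst h; simp [mulPath]
  · simp [mulPath, h]

theorem ofPath_mul_vertex [DecidableEq V] (a : V) (p : QPath V) :
    ofPath k p * vertex k a = if p.tgt = a then ofPath k p else 0 := by
  obtain ⟨b, c, p⟩ := p
  rw [vertex, ofPath_mul]
  by_cases h : c = a
  · subst h; simp [mulPath]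
  · simp [mulPath, h]

variable (k)

instance [Fintype V] : Ring (PathAlgebra k V) where
  __ := (inferInstance : AddCommGroup (PathAlgebra k V))
  mul := (· * ·)
  one := 1
  left_distrib x y z := (mulHom k x).map_add y z
  right_distrib x y z := by simp only [mul_def, map_add, LinearMap.add_apply]
  zero_mul x := by simp only [mul_def, map_zero, LinearMap.zero_apply]
  mul_zero x := by simp only [mul_def, map_zero]
  mul_assoc x y z := by
    induction x using induction with
    | h0 => simp only [mul_def, map_zero, LinearMap.zero_apply]
    | hadd x x' hx hx' =>
      simp only [mul_def, map_add, LinearMap.add_apply] at hx hx' ⊢; rw [hx, hx']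
    | hp p a =>
    induction y using induction with
    | h0 => simp only [mul_def, map_zero, LinearMap.zero_apply]
    | hadd x x' hx hx' =>
      simp only [mul_def, map_add, LinearMap.add_apply] at hx hx' ⊢; rw [hx, hx']
    | hp q b =>
    induction z using induction with
    | h0 => simp only [mul_def, map_zero]
    | hadd x x' hx hx' => simp only [mul_def, map_add] at hx hx' ⊢; rw [hx, hx']
    | hp r c =>
    have := ofPath_mul_assoc (k := k) p q r
    simp only [mul_def, map_smul, LinearMap.smul_apply] at this ⊢
    rw [this]
  one_mul x := by
    classical
    induction x using induction with
    | h0 => simp only [mul_def, map_zero]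
    | hadd x x' hx hx' => simp only [mul_def, map_add] at hx hx' ⊢; rw [hx, hx']
    | hp p a =>
    have h : ∀ b : V, mulHom k (vertex k b) (ofPath k p) = if b = p.src then ofPath k p else 0 :=
      fun b => vertex_mul_ofPath b p
    change mulHom k (∑ b : V, vertex k b) (a • ofPath k p) = _
    simp [LinearMap.sum_apply, h]
  mul_one x := by
    classical
    induction x using induction with
    | h0 => simp only [mul_def, map_zero, LinearMap.zero_apply]
    | hadd x x' hx hx' =>
      simp only [mul_def, map_add, LinearMap.add_apply] at hx hx' ⊢; rw [hx, hx']
    | hp p a =>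
    have h : ∀ b : V, mulHom k (ofPath k p) (vertex k b) = if p.tgt = b then ofPath k p else 0 :=
      fun b => ofPath_mul_vertex b p
    change mulHom k (a • ofPath k p) (∑ b : V, vertex k b) = _
    simp [h]

instance [Fintype V] : Algebra k (PathAlgebra k V) :=
  Algebra.ofModule
    (fun c x y => by simp only [mul_def, map_smul, LinearMap.smul_apply])
    (fun c x y => by simp only [mul_def, map_smul])

variable {k}

variable (k V) in
/-- The degree `n` part `kQ_n` of the path algebra. -/
def degreePart (n : ℕ) : Submodule k (PathAlgebra k V) :=
  Submodule.span k (ofPath k '' {p : QPath V | p.path.length = n})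

open Classical in
/-- The component of `x` in `kQ_n`. -/
def component (n : ℕ) (x : PathAlgebra k V) : PathAlgebra k V :=
  (basis k).repr.symm (((basis k).repr x).filter fun p => p.path.length = n)

/-- `x` is uniform with origin `a` and terminus `b`: it is nonzero, and all paths that occur in it
go from `a` to `b` and have the same length. -/
def IsUniform (x : PathAlgebra k V) (a b : V) : Prop :=
  x ≠ 0 ∧ ∃ l : ℕ, ∀ p, coeff x p ≠ 0 → p.src = a ∧ p.tgt = b ∧ p.path.length = l

end PathAlgebra


/-! ## Bimodules and tensor products over a noncommutative algebra -/

section Bimodules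

/-- The enveloping algebra `A ⊗ Aᵒᵖ`.  Bimodules over `A` are left modules over it, with
`a x b = (a ⊗ b) • x`. -/
def Env (k : Type u) (A : Type v) [Field k] [Ring A] [Algebra k A] : Type v :=
  A ⊗[k] Aᵐᵒᵖ

variable (k : Type u) {A : Type v} [Field k] [Ring A] [Algebra k A]

instance : Ring (Env k A) := inferInstanceAs (Ring (A ⊗[k] Aᵐᵒᵖ))

instance : Algebra k (Env k A) := inferInstanceAs (Algebra k (A ⊗[k] Aᵐᵒᵖ))

/-- The element `a ⊗ b` of `A ⊗ Aᵒᵖ`. -/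
def envTmul (a b : A) : Env k A := (a ⊗ₜ[k] op b : A ⊗[k] Aᵐᵒᵖ)

variable {k} in
theorem env_induction {P : Env k A → Prop} (z : Env k A) (h0 : P 0)
    (hadd : ∀ x y, P x → P y → P (x + y)) (ht : ∀ a b, P (envTmul k a b)) : P z :=
  TensorProduct.induction_on (motive := P) z h0 (fun a b => ht a b.unop) hadd

theorem envTmul_mul (a b a' b' : A) :
    envTmul k a b * envTmul k a' b' = envTmul k (a * a') (b' * b) :=
  Algebra.TensorProduct.tmul_mul_tmul (R := k) a a' (op b) (op b')

theorem envTmul_one : envTmul k (1 : A) 1 = 1 := rfl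

theorem envTmul_zero_left (b : A) : envTmul k 0 b = 0 := TensorProduct.zero_tmul _ _

theorem envTmul_zero_right (a : A) : envTmul k a 0 = 0 := TensorProduct.tmul_zero _ _

/-- The inclusion `A ⟶ A ⊗ Aᵒᵖ`, `a ↦ a ⊗ 1`. -/
def envLeft : A →ₐ[k] Env k A :=
  (Algebra.TensorProduct.includeLeft : A →ₐ[k] A ⊗[k] Aᵐᵒᵖ)

/-- The inclusion `Aᵒᵖ ⟶ A ⊗ Aᵒᵖ`, `b ↦ 1 ⊗ b`. -/
def envRight : Aᵐᵒᵖ →ₐ[k] Env k A :=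
  (Algebra.TensorProduct.includeRight : Aᵐᵒᵖ →ₐ[k] A ⊗[k] Aᵐᵒᵖ)

/-- `A` as a bimodule over itself: `(a ⊗ b) • x = a x b`. -/
instance envModuleSelf : Module (Env k A) A :=
  Module.compHom A (AlgHom.mulLeftRight k A : A ⊗[k] Aᵐᵒᵖ →+* Module.End k A)

theorem env_smul_self (a b x : A) : envTmul k a b • x = a * x * b :=
  AlgHom.mulLeftRight_apply k A a (op b) x

instance : IsScalarTower k (Env k A) A where
  smul_assoc c z x := by
    have h := map_smul (AlgHom.mulLeftRight k A) c z
    exact congrArg (fun f : Module.End k A => f x) h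

/-- The left action `a x` on a bimodule. -/
def lact {M : Type*} [AddCommGroup M] [Module (Env k A) M] (a : A) (x : M) : M :=
  envTmul k a 1 • x

/-- The right action `x a` on a bimodule. -/
def ract {M : Type*} [AddCommGroup M] [Module (Env k A) M] (x : M) (a : A) : M :=
  envTmul k 1 a • x

/-- `M ⊗ₖ N` for bimodules `M` and `N`, to be given its outer bimodule structure
`a (x ⊗ y) b = a x ⊗ y b`. -/
def OuterTensor (k : Type u) (_A : Type v) (M N : Type*) [Field k] [AddCommGroup M] [Module k M]
    [AddCommGroup N] [Module k N] : Type _ := M ⊗[k] N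

variable (A) (M N : Type*) [AddCommGroup M] [Module k M] [Module (Env k A) M]
  [IsScalarTower k (Env k A) M] [AddCommGroup N] [Module k N] [Module (Env k A) N]
  [IsScalarTower k (Env k A) N]

instance : AddCommGroup (OuterTensor k A M N) := inferInstanceAs (AddCommGroup (M ⊗[k] N))

instance : Module k (OuterTensor k A M N) := inferInstanceAs (Module k (M ⊗[k] N))

/-- The left action of `A` on `M ⊗ₖ N` through `M`. -/
def outerLeft : A →ₐ[k] Module.End k (M ⊗[k] N) :=
  (Module.End.rTensorAlgHom k M N).comp
    ((Algebra.lsmul k k M).comp (envLeft k))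

/-- The right action of `A` on `M ⊗ₖ N` through `N`. -/
def outerRight : Aᵐᵒᵖ →ₐ[k] Module.End k (M ⊗[k] N) :=
  (Module.End.lTensorAlgHom k N M).comp
    ((Algebra.lsmul k k N).comp (envRight k))

theorem outerLeft_tmul (a : A) (x : M) (y : N) :
    outerLeft k A M N a (x ⊗ₜ[k] y) = lact k a x ⊗ₜ[k] y := rfl

theorem outerRight_tmul (b : Aᵐᵒᵖ) (x : M) (y : N) :
    outerRight k A M N b (x ⊗ₜ[k] y) = x ⊗ₜ[k] ract k y b.unop := rfl

theorem outer_commute (a : A) (b : Aᵐᵒᵖ) :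
    Commute (outerLeft k A M N a) (outerRight k A M N b) := by
  refine TensorProduct.ext' fun x y => ?_
  rw [Module.End.mul_apply, Module.End.mul_apply, outerRight_tmul, outerLeft_tmul,
    outerLeft_tmul, outerRight_tmul]

/-- The outer action of the enveloping algebra on `M ⊗ₖ N`. -/
def outerAction : Env k A →ₐ[k] Module.End k (M ⊗[k] N) :=
  (Algebra.TensorProduct.lift (outerLeft k A M N) (outerRight k A M N) (outer_commute k A M N) :
    A ⊗[k] Aᵐᵒᵖ →ₐ[k] Module.End k (M ⊗[k] N))

theorem outerAction_tmul (a b : A) (x : M) (y : N) :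
    outerAction k A M N (envTmul k a b) (x ⊗ₜ[k] y) = lact k a x ⊗ₜ[k] ract k y b := by
  have h : outerAction k A M N (envTmul k a b) =
      outerLeft k A M N a * outerRight k A M N (op b) :=
    Algebra.TensorProduct.lift_tmul _ _ _ _ _
  rw [h, Module.End.mul_apply, outerRight_tmul, outerLeft_tmul]
  rfl

instance : Module (Env k A) (OuterTensor k A M N) :=
  Module.compHom (M ⊗[k] N) (outerAction k A M N).toRingHom

instance : IsScalarTower k (Env k A) (OuterTensor k A M N) where
  smul_assoc c z x := by
    have h := map_smul (outerAction k A M N) c z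
    exact congrArg (fun f : Module.End k (M ⊗[k] N) => f x) h

variable {k M N}

/-- The pure tensor `x ⊗ₖ y`. -/
def outerTmul (x : M) (y : N) : OuterTensor k A M N := x ⊗ₜ[k] y

variable (k M N)

/-- The sub-bimodule of `M ⊗ₖ N` generated by the elements `x a ⊗ y - x ⊗ a y`. -/
def balancedRelations : Submodule (Env k A) (OuterTensor k A M N) :=
  Submodule.span (Env k A) {z | ∃ (x : M) (a : A) (y : N),
    z = outerTmul A (ract k x a) y - outerTmul A x (lact k a y)}

/-- The tensor product `M ⊗_A N` of two `A`-bimodules, as an `A`-bimodule: the quotient of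
`M ⊗ₖ N` by the relations `x a ⊗ y = x ⊗ a y`. -/
def BalancedTensor : Type _ := OuterTensor k A M N ⧸ balancedRelations k A M N

instance : AddCommGroup (BalancedTensor k A M N) :=
  inferInstanceAs (AddCommGroup (OuterTensor k A M N ⧸ balancedRelations k A M N))

instance : Module (Env k A) (BalancedTensor k A M N) :=
  inferInstanceAs (Module (Env k A) (OuterTensor k A M N ⧸ balancedRelations k A M N))

instance : Module k (BalancedTensor k A M N) :=
  inferInstanceAs (Module k (OuterTensor k A M N ⧸ balancedRelations k A M N))

instance : IsScalarTower k (Env k A) (BalancedTensor k A M N) :=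
  inferInstanceAs (IsScalarTower k (Env k A) (OuterTensor k A M N ⧸ balancedRelations k A M N))

variable {M N}

/-- The pure tensor `x ⊗_A y`. -/
def btmul (x : M) (y : N) : BalancedTensor k A M N :=
  Submodule.Quotient.mk (p := balancedRelations k A M N) (outerTmul A x y)


variable {k A}

theorem lift_outerAction {L : Type*} [AddCommGroup L] [Module k L] [Module (Env k A) L]
    (g : M →ₗ[k] N →ₗ[k] L)
    (hg : ∀ (a b : A) (x : M) (y : N), g (lact k a x) (ract k y b) = envTmul k a b • g x y)
    (z : Env k A) (t : M ⊗[k] N) :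
    TensorProduct.lift g (outerAction k A M N z t) = z • TensorProduct.lift g t := by
  induction t using TensorProduct.induction_on with
  | zero => simp only [map_zero, smul_zero]
  | add x y hx hy => rw [map_add, map_add, hx, hy, map_add, smul_add]
  | tmul x y =>
  induction z using env_induction with
  | h0 => rw [map_zero, LinearMap.zero_apply, map_zero, zero_smul]
  | hadd z z' hz hz' => rw [map_add, LinearMap.add_apply, map_add, hz, hz', add_smul]
  | ht a b => rw [outerAction_tmul, TensorProduct.lift.tmul, TensorProduct.lift.tmul, hg]

/-- A balanced `k`-bilinear map that is compatible with the outer actions induces a map of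
bimodules on `M ⊗_A N`. -/
def balancedLift {L : Type*} [AddCommGroup L] [Module k L] [Module (Env k A) L]
    (g : M →ₗ[k] N →ₗ[k] L)
    (hg : ∀ (a b : A) (x : M) (y : N), g (lact k a x) (ract k y b) = envTmul k a b • g x y)
    (hbal : ∀ (x : M) (a : A) (y : N), g (ract k x a) y = g x (lact k a y)) :
    BalancedTensor k A M N →ₗ[Env k A] L :=
  Submodule.liftQ (balancedRelations k A M N)
    ({ toFun := fun z => TensorProduct.lift g z
       map_add' := fun x y => map_add (TensorProduct.lift g) x y
       map_smul' := fun z t => lift_outerAction g hg z t } : OuterTensor k A M N →ₗ[Env k A] L)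
    (by
      rw [balancedRelations, Submodule.span_le]
      rintro _ ⟨x, a, y, rfl⟩
      refine (map_sub (TensorProduct.lift g) (ract k x a ⊗ₜ[k] y) (x ⊗ₜ[k] lact k a y)).trans ?_
      rw [TensorProduct.lift.tmul, TensorProduct.lift.tmul, hbal, sub_self])

theorem balancedLift_btmul {L : Type*} [AddCommGroup L] [Module k L] [Module (Env k A) L]
    (g : M →ₗ[k] N →ₗ[k] L) (hg) (hbal) (x : M) (y : N) :
    balancedLift (A := A) g hg hbal (btmul k A x y) = g x y := rfl

theorem lact_lact {M : Type*} [AddCommGroup M] [Module (Env k A) M] (a b : A) (x : M) :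
    lact k a (lact k b x) = lact k (a * b) x := by
  rw [lact, lact, smul_smul, envTmul_mul, one_mul, lact]

theorem ract_ract {M : Type*} [AddCommGroup M] [Module (Env k A) M] (a b : A) (x : M) :
    ract k (ract k x a) b = ract k x (a * b) := by
  rw [ract, ract, smul_smul, envTmul_mul, one_mul, ract]

theorem envTmul_smul {M : Type*} [AddCommGroup M] [Module (Env k A) M] (a b : A) (x : M) :
    envTmul k a b • x = lact k a (ract k x b) := by
  rw [lact, ract, smul_smul, envTmul_mul, mul_one, mul_one]

theorem ract_lact {M : Type*} [AddCommGroup M] [Module (Env k A) M] (a b : A) (x : M) :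
    ract k (lact k a x) b = lact k a (ract k x b) := by
  rw [lact, ract, smul_smul, envTmul_mul, one_mul, one_mul, envTmul_smul]

theorem map_lact {M L : Type*} [AddCommGroup M] [Module (Env k A) M] [AddCommGroup L]
    [Module (Env k A) L] (η : M →ₗ[Env k A] L) (a : A) (x : M) :
    η (lact k a x) = lact k a (η x) := map_smul _ _ _

theorem map_ract {M L : Type*} [AddCommGroup M] [Module (Env k A) M] [AddCommGroup L]
    [Module (Env k A) L] (η : M →ₗ[Env k A] L) (a : A) (x : M) :
    η (ract k x a) = ract k (η x) a := map_smul _ _ _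

theorem lact_self (a x : A) : lact k a x = a * x := by rw [lact, env_smul_self, mul_one]

theorem ract_self (a x : A) : ract k x a = x * a := by rw [ract, env_smul_self, one_mul]

variable (N) in
/-- The map `η ⊗ 1 : M ⊗_A N ⟶ A ⊗_A N = N`, `x ⊗ y ↦ η(x) y`. -/
def evalLeft (η : M →ₗ[Env k A] A) : BalancedTensor k A M N →ₗ[Env k A] N :=
  balancedLift
    (((Algebra.lsmul k k N).comp (envLeft k)).toLinearMap.comp (η.restrictScalars k))
    (fun a b x y => by
      change lact k (η (lact k a x)) (ract k y b) = envTmul k a b • lact k (η x) y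
      rw [map_lact, lact_self, ← lact_lact, envTmul_smul, ract_lact])
    (fun x a y => by
      change lact k (η (ract k x a)) y = lact k (η x) (lact k a y)
      rw [map_ract, ract_self, ← lact_lact])

variable (M) in
/-- The map `1 ⊗ η : M ⊗_A N ⟶ M ⊗_A A = M`, `x ⊗ y ↦ x η(y)` (without the Koszul sign). -/
def evalRight (η : N →ₗ[Env k A] A) : BalancedTensor k A M N →ₗ[Env k A] M :=
  balancedLift
    (((Algebra.lsmul k k M).comp (envRight k)).toLinearMap.comp
      ((MulOpposite.opLinearEquiv k).toLinearMap.comp (η.restrictScalars k))).flip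
    (fun a b x y => by
      change ract k (lact k a x) (η (ract k y b)) = envTmul k a b • ract k x (η y)
      rw [map_ract, ract_self, ← ract_ract, envTmul_smul, ract_lact, ract_lact])
    (fun x a y => by
      change ract k (ract k x a) (η y) = ract k x (η (lact k a y))
      rw [map_lact, lact_self, ← ract_ract])

theorem evalLeft_btmul (η : M →ₗ[Env k A] A) (x : M) (y : N) :
    evalLeft N η (btmul k A x y) = lact k (η x) y := rfl

theorem evalRight_btmul (η : N →ₗ[Env k A] A) (x : M) (y : N) :
    evalRight M η (btmul k A x y) = ract k x (η y) := rfl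

theorem btmul_ract (x : M) (a : A) (y : N) :
    btmul k A (ract k x a) y = btmul k A x (lact k a y) :=
  (Submodule.Quotient.eq (balancedRelations k A M N)).2 (Submodule.subset_span ⟨x, a, y, rfl⟩)

theorem envTmul_smul_btmul (a b : A) (x : M) (y : N) :
    envTmul k a b • btmul k A x y = btmul k A (lact k a x) (ract k y b) :=
  congrArg (Submodule.Quotient.mk (p := balancedRelations k A M N))
    (outerAction_tmul k A M N a b x y)

theorem btmul_zero (x : M) : btmul k A x (0 : N) = 0 :=
  congrArg (Submodule.Quotient.mk (p := balancedRelations k A M N)) (TensorProduct.tmul_zero (R := k) N x)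

theorem zero_btmul (y : N) : btmul k A (0 : M) y = 0 :=
  congrArg (Submodule.Quotient.mk (p := balancedRelations k A M N)) (TensorProduct.zero_tmul (R := k) M y)

end Bimodules


/-! ## Homotopy liftings -/

section HomotopyLifting

variable {k : Type u} {A : Type v} [Field k] [Ring A] [Algebra k A]
  {P : ℕ → Type*} [∀ n, AddCommGroup (P n)] [∀ n, Module k (P n)] [∀ n, Module (Env k A) (P n)]
  [∀ n, IsScalarTower k (Env k A) (P n)]

/-- A cochain `η : P_n ⟶ A` is a cocycle if `η d = 0`.  The differential of `P` is given as a
family of maps `d i j : P_i ⟶ P_j`, of which only those with `i = j + 1` are relevant. -/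
def IsCocycle (d : ∀ i j, P i →ₗ[Env k A] P j) {n : ℕ} (η : P n →ₗ[Env k A] A) : Prop :=
  η ∘ₗ d (n + 1) n = 0

/-- The component `P_m ⟶ P_l`, `m = n + l`, of `(η ⊗ 1 - 1 ⊗ η) Δ` for a cochain
`η : P_n ⟶ A`, with the Koszul sign `(1 ⊗ η)(x ⊗ y) = (-1)^{n |x|} x η(y)`.
The map `Δ m a b` is the component `P_m ⟶ P_a ⊗_A P_b` of the diagonal map. -/
def commutatorMap (Δ : ∀ m a b, P m →ₗ[Env k A] BalancedTensor k A (P a) (P b)) {n : ℕ}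
    (η : P n →ₗ[Env k A] A) (m l : ℕ) : P m →ₗ[Env k A] P l :=
  evalLeft (P l) η ∘ₗ Δ m n l - (-1 : ℤ) ^ (n * l) • (evalRight (P l) η ∘ₗ Δ m l n)

/-- `ψ` is a homotopy lifting of the cocycle `η : P_n ⟶ A` with respect to the diagonal map `Δ`,
where `P` is a resolution of `A` with differential `d` (only `d (j + 1) j` is relevant, and
`d i j = 0` for `i ≠ j + 1`) and augmentation `μ : P_0 ⟶ A`.
A map `ψ : P ⟶ P[1 - n]` is given by its components `ψ m l : P_m ⟶ P_l` with `l + n = m + 1`.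
The first condition is `d ψ - (-1)^{n-1} ψ d = (η ⊗ 1 - 1 ⊗ η) Δ`; the second one is that
`μ ψ ∼ (-1)^{n-1} η φ` (cohomologous cochains on `P_{n-1}`) for some `φ : P ⟶ P[1]` such that
`d φ + φ d = (μ ⊗ 1 - 1 ⊗ μ) Δ`.
In degree `0` the terms `ψ d` and `ξ d` vanish, because `d 0 0 = 0`. -/
def IsHomotopyLifting (d : ∀ i j, P i →ₗ[Env k A] P j) (μ : P 0 →ₗ[Env k A] A)
    (Δ : ∀ m a b, P m →ₗ[Env k A] BalancedTensor k A (P a) (P b)) {n : ℕ}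
    (η : P n →ₗ[Env k A] A) (ψ : ∀ m l, P m →ₗ[Env k A] P l) : Prop :=
  (∀ m l, m = n + l →
    d (l + 1) l ∘ₗ ψ m (l + 1) - (-1 : ℤ) ^ (n + 1) • (ψ (m - 1) l ∘ₗ d m (m - 1)) =
      commutatorMap Δ η m l) ∧
  ∃ φ : ∀ m l, P m →ₗ[Env k A] P l,
    (∀ m, d (m + 1) m ∘ₗ φ m (m + 1) + φ (m - 1) m ∘ₗ d m (m - 1) = commutatorMap Δ μ m m) ∧
    ∀ m, m + 1 = n → ∃ ξ : P (m - 1) →ₗ[Env k A] A,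
      μ ∘ₗ ψ m 0 - (-1 : ℤ) ^ m • (η ∘ₗ φ m n) = ξ ∘ₗ d m (m - 1)

end HomotopyLifting

/-! ## Koszul algebras -/

section Koszul

/-- The right ideal of elements of positive degree of a graded algebra. -/
def positivePart {k : Type u} {A : Type v} [Field k] [Ring A] [Algebra k A]
    (𝒜 : ℕ → Submodule k A) : Submodule Aᵐᵒᵖ A :=
  Submodule.span Aᵐᵒᵖ {x | ∃ n, 0 < n ∧ x ∈ 𝒜 n}

/-- A linear graded projective resolution `⋯ ⟶ P_1 ⟶ P_0 ⟶ A_0` of the right module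
`A_0 = A / A_{>0}` over the graded algebra `A = ⨁ A_i`: each `P_n` is a graded projective right
`A`-module generated in degree `n`, and all maps preserve degrees. -/
structure LinearResolution {k : Type u} {A : Type v} [Field k] [Ring A] [Algebra k A]
    (𝒜 : ℕ → Submodule k A) where
  P : ℕ → Type v
  [addCommGroup : ∀ n, AddCommGroup (P n)]
  [module : ∀ n, Module Aᵐᵒᵖ (P n)]
  deg : ∀ n, ℕ → AddSubgroup (P n)
  isInternal : ∀ n, DirectSum.IsInternal (deg n)
  smul_mem : ∀ n i j (a : A) (x : P n), a ∈ 𝒜 i → x ∈ deg n j → op a • x ∈ deg n (j + i)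
  projective : ∀ n, Module.Projective Aᵐᵒᵖ (P n)
  generated : ∀ n, Submodule.span Aᵐᵒᵖ (deg n n : Set (P n)) = ⊤
  d : ∀ n, P (n + 1) →ₗ[Aᵐᵒᵖ] P n
  d_mem : ∀ n j x, x ∈ deg (n + 1) j → d n x ∈ deg n j
  aug : P 0 →ₗ[Aᵐᵒᵖ] A ⧸ positivePart 𝒜
  aug_eq_zero : ∀ j x, 0 < j → x ∈ deg 0 j → aug x = 0
  aug_surjective : Function.Surjective aug
  exact_zero : Function.Exact (d 0) aug
  exact : ∀ n, Function.Exact (d (n + 1)) (d n)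

end Koszul

/-! ## Quiver algebras and their bimodule resolutions -/

namespace PathAlgebra

variable {k : Type u} {V : Type v} [Quiver.{w} V] [Field k] [Fintype V]

/-- `I` is homogeneous for the grading of `kQ` by path length. -/
def IsGradedIdeal (I : Ideal (PathAlgebra k V)) : Prop :=
  ∀ x ∈ I, ∀ n, component n x ∈ I

/-- `I ⊆ J²`, where `J` is the ideal generated by the arrows: every path that occurs in an
element of `I` has length at least two. -/
def IsContainedInSquare (I : Ideal (PathAlgebra k V)) : Prop :=
  ∀ x ∈ I, ∀ p, coeff x p ≠ 0 → 2 ≤ p.path.length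

/-- The grading of `Λ = kQ/I` by path length. -/
def quotientGrading (I : Ideal (PathAlgebra k V)) [I.IsTwoSided] (n : ℕ) :
    Submodule k (PathAlgebra k V ⧸ I) :=
  (degreePart k V n).map (Ideal.Quotient.mkₐ k I).toLinearMap

/-- `Λ = kQ/I`, graded by path length, is a Koszul algebra: the right module `Λ_0` has a linear
graded projective resolution. -/
def IsKoszul (I : Ideal (PathAlgebra k V)) [I.IsTwoSided] : Prop :=
  Nonempty (LinearResolution (quotientGrading I))

/-- The right ideal `∑ f_i kQ`. -/
def rightSpan {t : ℕ} (f : Fin t → PathAlgebra k V) :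
    Submodule (PathAlgebra k V)ᵐᵒᵖ (PathAlgebra k V) :=
  Submodule.span _ (Set.range f)

/-- The right ideal `∑ f_i I`. -/
def rightSpanMul (I : Ideal (PathAlgebra k V)) {t : ℕ} (f : Fin t → PathAlgebra k V) :
    Submodule (PathAlgebra k V)ᵐᵒᵖ (PathAlgebra k V) :=
  Submodule.span _ {x | ∃ i, ∃ a ∈ I, x = f i * a}

/-- The right module `L = (∑ f_i kQ) / (∑ f_i I)`.  It is annihilated by `I`, so that it is a
right `Λ`-module. -/
abbrev RightModule (I : Ideal (PathAlgebra k V)) {t : ℕ} (f : Fin t → PathAlgebra k V) :=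
  rightSpan f ⧸ (rightSpanMul I f).comap (rightSpan f).subtype

theorem rightSpanMul_le (I : Ideal (PathAlgebra k V)) [I.IsTwoSided] {s t : ℕ}
    {f : Fin s → PathAlgebra k V} {g : Fin t → PathAlgebra k V} (h : ∀ i, g i ∈ rightSpan f) :
    rightSpanMul I g ≤ rightSpanMul I f := by
  refine Submodule.span_le.2 ?_
  rintro _ ⟨i, a, ha, rfl⟩
  have key : ∀ y ∈ rightSpan f, ∀ a ∈ I, y * a ∈ rightSpanMul I f := by
    intro y hy
    induction hy using Submodule.span_induction with
    | mem y hy =>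
      obtain ⟨j, rfl⟩ := hy
      exact fun a ha => Submodule.subset_span ⟨j, a, ha, rfl⟩
    | zero => intro a _; rw [zero_mul]; exact Submodule.zero_mem _
    | add y z _ _ hy hz =>
      intro a ha
      rw [add_mul]
      exact Submodule.add_mem _ (hy a ha) (hz a ha)
    | smul r y _ hy =>
      intro a ha
      have : r • y * a = y * (r.unop * a) := by
        rw [← mul_assoc]; rfl
      rw [this]
      exact hy _ (I.mul_mem_left _ ha)
  exact key _ (h i) a ha

/-- The map of right modules `(∑ g_i kQ) / (∑ g_i I) ⟶ (∑ f_i kQ) / (∑ f_i I)` that is induced by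
an inclusion `∑ g_i kQ ⊆ ∑ f_i kQ`. -/
def inclusionMap (I : Ideal (PathAlgebra k V)) [I.IsTwoSided] {s t : ℕ}
    {f : Fin s → PathAlgebra k V} {g : Fin t → PathAlgebra k V} (h : ∀ i, g i ∈ rightSpan f) :
    RightModule I g →ₗ[(PathAlgebra k V)ᵐᵒᵖ] RightModule I f :=
  Submodule.mapQ _ _
    (Submodule.inclusion (Submodule.span_le.2 (by rintro _ ⟨i, rfl⟩; exact h i)))
    (fun x hx => rightSpanMul_le I h hx)

/-- Elements `f^n_i` of `kQ` that define a minimal resolution `L ⟶ Λ_0` of right `Λ`-modules,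
together with scalars `c_{pq}(n,i,r)` for which they satisfy the comultiplicative equation. -/
structure ComultResolution (I : Ideal (PathAlgebra k V)) [I.IsTwoSided] where
  /-- the number of elements `f^n_i` -/
  t : ℕ → ℕ
  f : ∀ n, Fin (t n) → PathAlgebra k V
  /-- the origin of `f^n_i` -/
  orig : ∀ n, Fin (t n) → V
  /-- the terminus of `f^n_i` -/
  term : ∀ n, Fin (t n) → V
  uniform : ∀ n i, IsUniform (f n i) (orig n i) (term n i)
  /-- the `f^0_i` are the vertices -/
  vertexEquiv : Fin (t 0) ≃ V
  f_zero : ∀ i, f 0 i = vertex k (vertexEquiv i)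
  /-- the `f^1_i` are the arrows -/
  arrowEquiv : Fin (t 1) ≃ Σ a b : V, (a ⟶ b)
  f_one : ∀ i, f 1 i = arrow k (arrowEquiv i).2.2
  /-- the sum of the right ideals `f^n_i kQ` is direct -/
  independent : ∀ n, iSupIndep fun i => Submodule.span (PathAlgebra k V)ᵐᵒᵖ {f n i}
  /-- the right ideals `⨁ f^n_i kQ` are nested -/
  nested : ∀ n i, f (n + 1) i ∈ rightSpan (f n)
  /-- `L` is exact.  The cokernel of `L_1 ⟶ L_0 = kQ/I` is `Λ_0`, as the `f^1_i` are the arrows. -/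
  exact : ∀ n, Function.Exact (inclusionMap I (nested (n + 1))) (inclusionMap I (nested n))
  /-- `L` is minimal: the image of `L_{n+1}` in `L_n` lies in `L_n J`. -/
  minimal : ∀ n, LinearMap.range (inclusionMap I (nested n)) ≤
    Submodule.span (PathAlgebra k V)ᵐᵒᵖ
      {y | ∃ (x : RightModule I (f n)) (a b : V) (α : a ⟶ b), y = op (arrow k α) • x}
  /-- `c n r s i p q` is the coefficient `c_{pq}(n,i,r)` of `f^r_p f^s_q` in `f^n_i`, where
  `n = r + s` (other values are irrelevant). -/
  c : ∀ n r s, Fin (t n) → Fin (t r) → Fin (t s) → k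
  comult : ∀ n r s, r + s = n → ∀ i, f n i = ∑ p, ∑ q, c n r s i p q • (f r p * f s q)

namespace ComultResolution

variable {I : Ideal (PathAlgebra k V)} [I.IsTwoSided] (D : ComultResolution I)

/-- The idempotent `o(f^n_i) ⊗ t(f^n_i)` of `Λ ⊗ Λᵒᵖ`. -/
def idem (n : ℕ) (i : Fin (D.t n)) : Env k (PathAlgebra k V ⧸ I) :=
  envTmul k (Ideal.Quotient.mk I (vertex k (D.orig n i)))
    (Ideal.Quotient.mk I (vertex k (D.term n i)))

/-- The bimodule `K_n = ⨁ Λ o(f^n_i) ⊗ t(f^n_i) Λ`.  The summand `Λ o ⊗ t Λ` is the left ideal of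
`Λ ⊗ Λᵒᵖ` generated by the idempotent `o ⊗ t`. -/
def K (n : ℕ) : Type _ :=
  ∀ i : Fin (D.t n), Submodule.span (Env k (PathAlgebra k V ⧸ I)) {D.idem n i}

instance (n : ℕ) : AddCommGroup (D.K n) :=
  inferInstanceAs (AddCommGroup
    (∀ i : Fin (D.t n), Submodule.span (Env k (PathAlgebra k V ⧸ I)) {D.idem n i}))

instance (n : ℕ) : Module (Env k (PathAlgebra k V ⧸ I)) (D.K n) :=
  inferInstanceAs (Module _
    (∀ i : Fin (D.t n), Submodule.span (Env k (PathAlgebra k V ⧸ I)) {D.idem n i}))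

instance (n : ℕ) : Module k (D.K n) :=
  inferInstanceAs (Module k
    (∀ i : Fin (D.t n), Submodule.span (Env k (PathAlgebra k V ⧸ I)) {D.idem n i}))

instance (n : ℕ) : IsScalarTower k (Env k (PathAlgebra k V ⧸ I)) (D.K n) :=
  inferInstanceAs (IsScalarTower k (Env k (PathAlgebra k V ⧸ I))
    (∀ i : Fin (D.t n), Submodule.span (Env k (PathAlgebra k V ⧸ I)) {D.idem n i}))

/-- The projection of `K_n` to its `i`-th summand, regarded as a submodule of `Λ ⊗ Λᵒᵖ`. -/
def proj (n : ℕ) (i : Fin (D.t n)) :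
    D.K n →ₗ[Env k (PathAlgebra k V ⧸ I)] Env k (PathAlgebra k V ⧸ I) where
  toFun x := (x i).1
  map_add' _ _ := rfl
  map_smul' _ _ := rfl

/-- The basis element `ε^n_i = (0, …, o(f^n_i) ⊗ t(f^n_i), …, 0)` of `K_n`. -/
def ε (n : ℕ) (i : Fin (D.t n)) : D.K n :=
  fun j => Pi.single (M := fun j => Submodule.span (Env k (PathAlgebra k V ⧸ I)) {D.idem n j})
    i ⟨D.idem n i, Submodule.mem_span_singleton_self _⟩ j

theorem proj_ε (n : ℕ) (i j : Fin (D.t n)) :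
    D.proj n j (D.ε n i) = if j = i then D.idem n i else 0 := by
  change ((D.ε n i) j).1 = _
  unfold ε
  split_ifs with h
  · subst h; rw [Pi.single_eq_same]
  · rw [Pi.single_eq_of_ne h]; rfl

theorem ext_proj {n : ℕ} {x y : D.K n} (h : ∀ i, D.proj n i x = D.proj n i y) : x = y :=
  funext fun i => Subtype.ext (h i)

/-- The map of bimodules `K_n ⟶ M` that takes `ε^n_i` to `o(f^n_i) m_i t(f^n_i)`. -/
def lift (n : ℕ) {M : Type*} [AddCommGroup M] [Module (Env k (PathAlgebra k V ⧸ I)) M]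
    (m : Fin (D.t n) → M) : D.K n →ₗ[Env k (PathAlgebra k V ⧸ I)] M :=
  ∑ i, LinearMap.toSpanSingleton (Env k (PathAlgebra k V ⧸ I)) M (m i) ∘ₗ D.proj n i

/-- The element of `K_{n-1}` that is the value of the differential at `ε^n_i`. -/
def dValue (n n' : ℕ) (i : Fin (D.t n)) : D.K n' :=
  ∑ j, (∑ p, D.c n 1 n' i p j • lact k (Ideal.Quotient.mk I (D.f 1 p)) (D.ε n' j) +
    (-1 : ℤ) ^ n • ∑ q, D.c n n' 1 i j q • ract k (D.ε n' j) (Ideal.Quotient.mk I (D.f 1 q)))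

/-- The differential `d_n : K_n ⟶ K_{n-1}` (and the zero map `K_n ⟶ K_{n'}` for `n ≠ n' + 1`). -/
def d (n n' : ℕ) : D.K n →ₗ[Env k (PathAlgebra k V ⧸ I)] D.K n' :=
  if n = n' + 1 then D.lift n (D.dValue n n') else 0

/-- The augmentation `K_0 ⟶ Λ`, the multiplication map `ε^0_i ↦ f^0_i`. -/
def μ : D.K 0 →ₗ[Env k (PathAlgebra k V ⧸ I)] (PathAlgebra k V ⧸ I) :=
  D.lift 0 fun i => Ideal.Quotient.mk I (D.f 0 i)

/-- The value at `ε^n_i` of the component `K_n ⟶ K_r ⊗_Λ K_s` of the diagonal map. -/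
def ΔValue (n r s : ℕ) (i : Fin (D.t n)) :
    BalancedTensor k (PathAlgebra k V ⧸ I) (D.K r) (D.K s) :=
  ∑ p, ∑ q, D.c n r s i p q • btmul k _ (D.ε r p) (D.ε s q)

/-- The components `K_n ⟶ K_r ⊗_Λ K_s`, `r + s = n`, of the diagonal map `Δ : K ⟶ K ⊗_Λ K`
(and the zero map for `r + s ≠ n`). -/
def Δ (n r s : ℕ) : D.K n →ₗ[Env k (PathAlgebra k V ⧸ I)]
    BalancedTensor k (PathAlgebra k V ⧸ I) (D.K r) (D.K s) :=
  if r + s = n then D.lift n (D.ΔValue n r s) else 0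

end ComultResolution

end PathAlgebra


/-! ## The values of `d` and `Δ` on the elements `ε^n_i`

The lemmas below show that `d` and `Δ` take `ε^n_i` to `dValue` and `ΔValue`. -/

namespace PathAlgebra

variable {k : Type u} {V : Type v} [Quiver.{w} V] [Field k]

theorem coeff_ofPath_mul (a b c : V) (p q : Quiver.Path a b) (hl : q.length = p.length)
    (r : QPath V) (s : Quiver.Path b c) :
    coeff (ofPath k ⟨a, b, q⟩ * ofPath k r) ⟨a, c, p.comp s⟩ =
      coeff (ofPath k ⟨a, b, q⟩) ⟨a, b, p⟩ * coeff (ofPath k r) ⟨b, c, s⟩ := by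
  classical
  obtain ⟨b', c', r⟩ := r
  rw [ofPath_mul]
  by_cases h : b = b'
  · subst h
    by_cases h' : c' = c
    · subst h'
      have := Quiver.Path.comp_inj' (q₁ := r) (q₂ := s) hl
      by_cases h1 : q = p <;> by_cases h2 : r = s <;>
        simp [mulPath, coeff, ofPath, this, h1, h2]
    · simp [mulPath, coeff, ofPath, Finsupp.single_apply, h']
  · simp [mulPath, coeff, ofPath, h, Finsupp.single_apply]

theorem coeff_uniform_mul {x : PathAlgebra k V} {a b : V} {l : ℕ}
    (hx : ∀ p, coeff x p ≠ 0 → p.src = a ∧ p.tgt = b ∧ p.path.length = l)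
    (y : PathAlgebra k V) (c : V) (p : Quiver.Path a b) (hp : p.length = l)
    (s : Quiver.Path b c) :
    coeff (x * y) ⟨a, c, p.comp s⟩ = coeff x ⟨a, b, p⟩ * coeff y ⟨b, c, s⟩ := by
  have hadd : ∀ u v : PathAlgebra k V, ∀ p, coeff (u + v) p = coeff u p + coeff v p := by
    intro u v p; simp [coeff]
  have hsmul : ∀ (e : k) (v : PathAlgebra k V), ∀ p, coeff (e • v) p = e * coeff v p := by
    intro u v p; simp [coeff]
  induction y using induction with
  | h0 => simp [mul_def, coeff]
  | hadd y z hy hz =>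
    rw [mul_def, map_add, ← mul_def, ← mul_def, hadd, hadd, hy, hz, mul_add]
  | hp r e =>
    rw [mul_def, map_smul, ← mul_def, hsmul, hsmul]
    suffices h : coeff (x * ofPath k r) ⟨a, c, p.comp s⟩ =
        coeff x ⟨a, b, p⟩ * coeff (ofPath k r) ⟨b, c, s⟩ by rw [h]; ring
    have hsum : x = ∑ q ∈ ((basis k).repr x).support, coeff x q • ofPath k q := by
      conv_lhs => rw [← (basis k).linearCombination_repr x]
      rfl
    have key : ∀ q ∈ ((basis k).repr x).support,
        coeff (ofPath k q * ofPath k r) ⟨a, c, p.comp s⟩ =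
          coeff (ofPath k q) ⟨a, b, p⟩ * coeff (ofPath k r) ⟨b, c, s⟩ := by
      intro q hq
      obtain ⟨a', b', q⟩ := q
      obtain ⟨h1, h2, h3⟩ := hx ⟨a', b', q⟩ (Finsupp.mem_support_iff.1 hq)
      dsimp only at h1 h2 h3
      subst h1 h2
      exact coeff_ofPath_mul _ _ _ _ _ (h3.trans hp.symm) _ _
    have hsumc : ∀ (S : Finset (QPath V)) (g : QPath V → PathAlgebra k V) (q : QPath V),
        coeff (∑ i ∈ S, g i) q = ∑ i ∈ S, coeff (g i) q := by
      intro S g q; simp [coeff, Finsupp.finsetSum_apply]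
    have e1 : x * ofPath k r =
        ∑ q ∈ ((basis k).repr x).support, coeff x q • (ofPath k q * ofPath k r) := by
      conv_lhs => rw [hsum]
      simp [mul_def, LinearMap.sum_apply]
    have e2 : coeff x ⟨a, b, p⟩ =
        ∑ q ∈ ((basis k).repr x).support, coeff x q * coeff (ofPath k q) ⟨a, b, p⟩ := by
      conv_lhs => rw [hsum, hsumc]
      simp [hsmul]
    rw [e1, hsumc, e2, Finset.sum_mul]
    exact Finset.sum_congr rfl fun q hq => by rw [hsmul, key q hq, mul_assoc]

theorem ext_coeff {x y : PathAlgebra k V} (h : ∀ p, coeff x p = coeff y p) : x = y :=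
  (basis k).repr.injective (Finsupp.ext h)

theorem coeff_vertex_mul [DecidableEq V] (a : V) (x : PathAlgebra k V) (p : QPath V) :
    coeff (vertex k a * x) p = if a = p.src then coeff x p else 0 := by
  classical
  induction x using induction with
  | h0 => simp [mul_def, coeff]
  | hadd y z hy hz =>
    have e : vertex k a * (y + z) = vertex k a * y + vertex k a * z := by simp [mul_def]
    have hadd : ∀ u v : PathAlgebra k V, coeff (u + v) p = coeff u p + coeff v p := by
      intro u v; simp [coeff]
    rw [e, hadd, hadd, hy, hz]; split_ifs <;> simp
  | hp r e =>
    have h : vertex k a * e • ofPath k r = e • (vertex k a * ofPath k r) := by simp [mul_def]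
    rw [h, vertex_mul_ofPath]
    by_cases h1 : r = p
    · subst h1; split_ifs <;> simp [coeff]
    · have : coeff (e • ofPath k r) p = 0 := by simp [coeff, ofPath, h1]
      split_ifs <;> simp [this] <;> simp [coeff]

theorem coeff_mul_vertex [DecidableEq V] (a : V) (x : PathAlgebra k V) (p : QPath V) :
    coeff (x * vertex k a) p = if p.tgt = a then coeff x p else 0 := by
  classical
  induction x using induction with
  | h0 => simp [mul_def, coeff]
  | hadd y z hy hz =>
    have e : (y + z) * vertex k a = y * vertex k a + z * vertex k a := by simp [mul_def]
    have hadd : ∀ u v : PathAlgebra k V, coeff (u + v) p = coeff u p + coeff v p := by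
      intro u v; simp [coeff]
    rw [e, hadd, hadd, hy, hz]; split_ifs <;> simp
  | hp r e =>
    have h : e • ofPath k r * vertex k a = e • (ofPath k r * vertex k a) := by simp [mul_def]
    rw [h, ofPath_mul_vertex]
    by_cases h1 : r = p
    · subst h1; split_ifs <;> simp [coeff]
    · have : coeff (e • ofPath k r) p = 0 := by simp [coeff, ofPath, h1]
      split_ifs <;> simp [this] <;> simp [coeff]

/-- Uniform elements can be cancelled on the left. -/
theorem IsUniform.cancel {x y : PathAlgebra k V} {a b : V} (hx : IsUniform x a b)
    (h : x * y = 0) : vertex k b * y = 0 := by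
  classical
  obtain ⟨hx0, l, hl⟩ := hx
  obtain ⟨⟨a', b', p⟩, hp⟩ : ∃ p, coeff x p ≠ 0 := by
    by_contra! hc
    exact hx0 (ext_coeff fun p => by rw [hc p]; simp [coeff])
  obtain ⟨h1, h2, h3⟩ := hl _ hp
  dsimp only at h1 h2 h3
  subst h1 h2
  refine ext_coeff fun q => ?_
  rw [coeff_vertex_mul]
  obtain ⟨b'', c, q⟩ := q
  by_cases hb : b' = b''
  · subst hb
    have := coeff_uniform_mul hl y c p h3 q
    rw [h] at this
    have h0 : coeff (0 : PathAlgebra k V) ⟨a', c, p.comp q⟩ = 0 := by simp [coeff]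
    rw [h0] at this
    rcases mul_eq_zero.1 this.symm with h | h
    · exact absurd h hp
    · simp [h]; simp [coeff]
  · simp [hb]; simp [coeff]

theorem IsUniform.vertex_mul [DecidableEq V] {x : PathAlgebra k V} {a b : V}
    (hx : IsUniform x a b) (c : V) : vertex k c * x = if c = a then x else 0 := by
  obtain ⟨hx0, l, hl⟩ := hx
  refine ext_coeff fun q => ?_
  rw [coeff_vertex_mul]
  by_cases h : coeff x q = 0
  · have h0 : coeff (0 : PathAlgebra k V) q = 0 := by simp [coeff]
    split_ifs <;> simp [h, h0]
  · obtain ⟨h1, h2, h3⟩ := hl _ h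
    subst h1
    split_ifs
    · rfl
    · simp [coeff]

theorem IsUniform.mul_vertex [DecidableEq V] {x : PathAlgebra k V} {a b : V}
    (hx : IsUniform x a b) (c : V) : x * vertex k c = if b = c then x else 0 := by
  obtain ⟨hx0, l, hl⟩ := hx
  refine ext_coeff fun q => ?_
  rw [coeff_mul_vertex]
  by_cases h : coeff x q = 0
  · have h0 : coeff (0 : PathAlgebra k V) q = 0 := by simp [coeff]
    split_ifs <;> simp [h, h0]
  · obtain ⟨h1, h2, h3⟩ := hl _ h
    subst h2
    split_ifs
    · rfl
    · simp [coeff]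


namespace ComultResolution

variable [Fintype V] {I : Ideal (PathAlgebra k V)} [I.IsTwoSided] (D : ComultResolution I)

theorem eq_zero_of_sum_mul (n : ℕ) (y : Fin (D.t n) → PathAlgebra k V)
    (h : ∑ i, D.f n i * y i = 0) (i : Fin (D.t n)) : vertex k (D.term n i) * y i = 0 := by
  refine (D.uniform n i).cancel ?_
  have := D.independent n
  rw [iSupIndep_iff_finsetSum_eq_zero_imp_eq_zero] at this
  exact this Finset.univ (fun i => D.f n i * y i)
    (fun i _ => Submodule.mem_span_singleton.2 ⟨op (y i), rfl⟩) h i (Finset.mem_univ i)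

theorem linearIndependent (n : ℕ) (b : Fin (D.t n) → k) (h : ∑ i, b i • D.f n i = 0)
    (i : Fin (D.t n)) : b i = 0 := by
  have := D.eq_zero_of_sum_mul n (fun i => b i • 1) (by simpa using h) i
  have h1 : b i • vertex k (D.term n i) = 0 := by simpa using this
  have h2 : vertex k (D.term n i) ≠ 0 := (basis k).ne_zero _
  exact (smul_eq_zero.1 h1).resolve_right h2

theorem coeff_eq_zero (r s : ℕ) (b : Fin (D.t r) → Fin (D.t s) → k)
    (h : ∑ p, ∑ q, b p q • (D.f r p * D.f s q) = 0) (p : Fin (D.t r)) (q : Fin (D.t s))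
    (hpq : D.term r p = D.orig s q) : b p q = 0 := by
  classical
  have h1 := D.eq_zero_of_sum_mul r (fun p => ∑ q, b p q • D.f s q)
    (by simpa [Finset.mul_sum] using h) p
  have h2 : ∑ q, (if D.term r p = D.orig s q then b p q else 0) • D.f s q = 0 := by
    rw [← h1, Finset.mul_sum]
    refine Finset.sum_congr rfl fun q _ => ?_
    rw [mul_smul_comm, (D.uniform s q).vertex_mul]
    split_ifs <;> simp
  simpa [hpq] using D.linearIndependent s _ h2 q

/-- A coefficient `c_{pq}(n,i,r)` of a composable pair vanishes unless the end points match. -/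
theorem c_endpoints (n r s : ℕ) (hn : r + s = n) (i : Fin (D.t n)) (p : Fin (D.t r))
    (q : Fin (D.t s)) (hpq : D.term r p = D.orig s q) (hc : D.c n r s i p q ≠ 0) :
    D.orig r p = D.orig n i ∧ D.term s q = D.term n i := by
  classical
  have hi := D.comult n r s hn i
  constructor
  · by_contra hne
    have h := (D.uniform n i).vertex_mul (D.orig r p)
    rw [if_neg hne, hi, Finset.mul_sum] at h
    have h2 : ∑ p', ∑ q', (if D.orig r p = D.orig r p' then D.c n r s i p' q' else 0) •
        (D.f r p' * D.f s q') = 0 := by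
      rw [← h]
      refine Finset.sum_congr rfl fun p' _ => ?_
      rw [Finset.mul_sum]
      refine Finset.sum_congr rfl fun q' _ => ?_
      rw [mul_smul_comm, ← mul_assoc, (D.uniform r p').vertex_mul]
      split_ifs <;> simp
    exact hc (by simpa using D.coeff_eq_zero r s _ h2 p q hpq)
  · by_contra hne
    have h := (D.uniform n i).mul_vertex (D.term s q)
    rw [if_neg (Ne.symm hne), hi, Finset.sum_mul] at h
    have h2 : ∑ p', ∑ q', (if D.term s q' = D.term s q then D.c n r s i p' q' else 0) •
        (D.f r p' * D.f s q') = 0 := by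
      rw [← h]
      refine Finset.sum_congr rfl fun p' _ => ?_
      rw [Finset.sum_mul]
      refine Finset.sum_congr rfl fun q' _ => ?_
      rw [smul_mul_assoc, mul_assoc, (D.uniform s q').mul_vertex]
      split_ifs <;> simp
    exact hc (by simpa using D.coeff_eq_zero r s _ h2 p q hpq)

end ComultResolution
end PathAlgebra

theorem zero_lact {k : Type u} {A : Type v} [Field k] [Ring A] [Algebra k A] {M : Type*}
    [AddCommGroup M] [Module (Env k A) M] (x : M) : lact k (0 : A) x = 0 := by
  rw [lact, envTmul_zero_left, zero_smul]
theorem ract_zero {k : Type u} {A : Type v} [Field k] [Ring A] [Algebra k A] {M : Type*}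
    [AddCommGroup M] [Module (Env k A) M] (x : M) : ract k x (0 : A) = 0 := by
  rw [ract, envTmul_zero_right, zero_smul]
theorem lact_zero {k : Type u} {A : Type v} [Field k] [Ring A] [Algebra k A] {M : Type*}
    [AddCommGroup M] [Module (Env k A) M] (a : A) : lact k a (0 : M) = 0 := by
  rw [lact, smul_zero]
theorem zero_ract {k : Type u} {A : Type v} [Field k] [Ring A] [Algebra k A] {M : Type*}
    [AddCommGroup M] [Module (Env k A) M] (a : A) : ract k (0 : M) a = 0 := by
  rw [ract, smul_zero]

namespace PathAlgebra
variable {k : Type u} {V : Type v} [Quiver.{w} V] [Field k]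
namespace ComultResolution

variable [Fintype V] {I : Ideal (PathAlgebra k V)} [I.IsTwoSided] (D : ComultResolution I)

theorem lift_ε (n : ℕ) {M : Type*} [AddCommGroup M] [Module (Env k (PathAlgebra k V ⧸ I)) M]
    (m : Fin (D.t n) → M) (i) : D.lift n m (D.ε n i) = D.idem n i • m i := by
  rw [lift, LinearMap.sum_apply, Finset.sum_eq_single i]
  · rw [LinearMap.comp_apply, proj_ε, if_pos rfl, LinearMap.toSpanSingleton_apply]
  · intro b _ hb
    rw [LinearMap.comp_apply, proj_ε, if_neg hb, map_zero]
  · simp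

theorem sum_proj (n : ℕ) (x : D.K n) : x = ∑ i, D.proj n i x • D.ε n i := by
  classical
  refine D.ext_proj fun j => ?_
  rw [map_sum, Finset.sum_eq_single j]
  · rw [map_smul, proj_ε, if_pos rfl]
    obtain ⟨z, hz⟩ := Submodule.mem_span_singleton.1 (x j).2
    have h : D.proj n j x = z • D.idem n j := hz.symm
    rw [h, smul_eq_mul, smul_eq_mul, mul_assoc]
    congr 1
    rw [idem, envTmul_mul, ← map_mul, ← map_mul]
    have : ∀ a : V, vertex k a * vertex k a = vertex k a := fun a => by
      exact (vertex_mul_ofPath a ⟨a, a, .nil⟩).trans (if_pos rfl)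
    rw [this, this]
  · intro b _ hb
    rw [map_smul, proj_ε, if_neg hb.symm, smul_zero]
  · simp

theorem hom_ext (n : ℕ) {M : Type*} [AddCommGroup M] [Module (Env k (PathAlgebra k V ⧸ I)) M]
    (g h : D.K n →ₗ[Env k (PathAlgebra k V ⧸ I)] M) (H : ∀ i, g (D.ε n i) = h (D.ε n i)) :
    g = h := by
  refine LinearMap.ext fun x => ?_
  rw [D.sum_proj n x, map_sum, map_sum]
  exact Finset.sum_congr rfl fun i _ => by rw [map_smul, map_smul, H]

theorem mk_vertex_mul_vertex [DecidableEq V] (a b : V) :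
    vertex k a * vertex k b = if a = b then vertex k a else 0 := by
  have h := vertex_mul_ofPath (k := k) a ⟨b, b, .nil⟩
  rw [← vertex] at h
  rw [h]
  split_ifs with h
  · dsimp only at h; subst h; rfl
  · rfl

theorem smul_ε_self (n i) (z : Env k (PathAlgebra k V ⧸ I)) (h : z * D.idem n i = D.idem n i) :
    z • D.ε n i = D.ε n i := by
  refine D.ext_proj fun j => ?_
  rw [map_smul, proj_ε]
  split_ifs with h'
  · exact h
  · rw [smul_zero]

theorem smul_ε_zero (n i) (z : Env k (PathAlgebra k V ⧸ I)) (h : z * D.idem n i = 0) :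
    z • D.ε n i = 0 := by
  refine D.ext_proj fun j => ?_
  rw [map_smul, proj_ε, map_zero]
  split_ifs with h'
  · exact h
  · rw [smul_zero]

theorem lact_ε [DecidableEq V] (n i) (a : V) :
    lact k (Ideal.Quotient.mk I (vertex k a)) (D.ε n i) = if a = D.orig n i then D.ε n i else 0 := by
  rw [lact]
  split_ifs with h
  · refine D.smul_ε_self n i _ ?_
    rw [idem, envTmul_mul, ← map_mul, mk_vertex_mul_vertex, if_pos h, mul_one, h]
  · refine D.smul_ε_zero n i _ ?_
    rw [idem, envTmul_mul, ← map_mul, mk_vertex_mul_vertex, if_neg h, map_zero, envTmul_zero_left]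

theorem ract_ε [DecidableEq V] (n i) (a : V) :
    ract k (D.ε n i) (Ideal.Quotient.mk I (vertex k a)) = if D.term n i = a then D.ε n i else 0 := by
  rw [ract]
  split_ifs with h
  · refine D.smul_ε_self n i _ ?_
    rw [idem, envTmul_mul, ← map_mul, mk_vertex_mul_vertex, if_pos h, one_mul]
  · refine D.smul_ε_zero n i _ ?_
    rw [idem, envTmul_mul, ← map_mul, mk_vertex_mul_vertex, if_neg h, map_zero, envTmul_zero_right]

theorem idem_smul (n i) {M : Type*} [AddCommGroup M] [Module (Env k (PathAlgebra k V ⧸ I)) M]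
    (x : M) : D.idem n i • x = lact k (Ideal.Quotient.mk I (vertex k (D.orig n i)))
      (ract k x (Ideal.Quotient.mk I (vertex k (D.term n i)))) := envTmul_smul _ _ _

theorem btmul_eq_zero (r s : ℕ) (p q) (hpq : D.term r p ≠ D.orig s q) :
    btmul k (PathAlgebra k V ⧸ I) (D.ε r p) (D.ε s q) = 0 := by
  classical
  have := btmul_ract (k := k) (D.ε r p) (Ideal.Quotient.mk I (vertex k (D.term r p))) (D.ε s q)
  rwa [lact_ε, ract_ε, if_pos rfl, if_neg hpq, btmul_zero] at this

theorem lact_f_ε (n p j) (h : D.term 1 p ≠ D.orig n j) :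
    lact k (Ideal.Quotient.mk I (D.f 1 p)) (D.ε n j) = 0 := by
  classical
  have h' := lact_lact (k := k) (Ideal.Quotient.mk I (D.f 1 p)) (Ideal.Quotient.mk I (vertex k (D.term 1 p))) (D.ε n j)
  rw [lact_ε, if_neg h, ← map_mul, (D.uniform 1 p).mul_vertex, if_pos rfl, lact_zero] at h'
  exact h'.symm

theorem ract_f_ε (n q j) (h : D.term n j ≠ D.orig 1 q) :
    ract k (D.ε n j) (Ideal.Quotient.mk I (D.f 1 q)) = 0 := by
  classical
  have h' := ract_ract (k := k) (Ideal.Quotient.mk I (vertex k (D.orig 1 q))) (Ideal.Quotient.mk I (D.f 1 q)) (D.ε n j)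
  rw [ract_ε, if_neg h, ← map_mul, (D.uniform 1 q).vertex_mul, if_pos rfl, zero_ract] at h'
  exact h'.symm

theorem Δ_ε (n r s : ℕ) (hn : r + s = n) (i) : D.Δ n r s (D.ε n i) = D.ΔValue n r s i := by
  classical
  rw [Δ, if_pos hn, lift_ε, ΔValue]
  have key : ∀ p q, D.idem n i • (D.c n r s i p q • btmul k (PathAlgebra k V ⧸ I) (D.ε r p) (D.ε s q))
      = D.c n r s i p q • btmul k (PathAlgebra k V ⧸ I) (D.ε r p) (D.ε s q) := by
    intro p q
    by_cases hpq : D.term r p = D.orig s q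
    · by_cases hc : D.c n r s i p q = 0
      · simp only [hc, zero_smul, smul_zero]
      · obtain ⟨h1, h2⟩ := D.c_endpoints n r s hn i p q hpq hc
        have h3 : D.idem n i • btmul k (PathAlgebra k V ⧸ I) (D.ε r p) (D.ε s q) =
            btmul k (PathAlgebra k V ⧸ I) (D.ε r p) (D.ε s q) := by
          have h4 := envTmul_smul_btmul (k := k) (Ideal.Quotient.mk I (vertex k (D.orig n i))) (Ideal.Quotient.mk I (vertex k (D.term n i))) (D.ε r p) (D.ε s q)
          have h5 := D.lact_ε r p (D.orig n i)
          have h6 := D.ract_ε s q (D.term n i)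
          rw [if_pos h1.symm] at h5
          rw [if_pos h2] at h6
          rw [h5, h6] at h4
          exact h4
        exact (smul_algebra_smul_comm (D.c n r s i p q) (D.idem n i) (btmul k (PathAlgebra k V ⧸ I) (D.ε r p) (D.ε s q))).trans (congrArg (D.c n r s i p q • ·) h3)
    · have h3 := D.btmul_eq_zero r s p q hpq
      simp only [h3, smul_zero]
  rw [Finset.smul_sum]
  refine Finset.sum_congr rfl fun p _ => ?_
  rw [Finset.smul_sum]
  exact Finset.sum_congr rfl fun q _ => key p q

theorem d_ε (n n' : ℕ) (hn : n = n' + 1) (i) : D.d n n' (D.ε n i) = D.dValue n n' i := by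
  classical
  rw [d, if_pos hn, lift_ε, dValue]
  simp only [Finset.smul_sum, smul_add]
  refine Finset.sum_congr rfl fun j _ => ?_
  congr 1
  · refine Finset.sum_congr rfl fun p _ => ?_
    rw [smul_algebra_smul_comm]
    by_cases hpq : D.term 1 p = D.orig n' j
    · by_cases hc : D.c n 1 n' i p j = 0
      · rw [hc, zero_smul, zero_smul]
      · obtain ⟨h1, h2⟩ := D.c_endpoints n 1 n' (by omega) i p j hpq hc
        rw [idem_smul, ract_lact, lact_lact, ract_ε, ← map_mul, (D.uniform 1 p).vertex_mul,
          if_pos h1.symm, if_pos h2]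
    · rw [lact_f_ε _ _ _ _ hpq, smul_zero]
  · refine Finset.sum_congr rfl fun q _ => ?_
    rw [smul_comm (D.idem n i), smul_algebra_smul_comm]
    congr 1
    by_cases hpq : D.term n' j = D.orig 1 q
    · by_cases hc : D.c n n' 1 i j q = 0
      · rw [hc, zero_smul, zero_smul]
      · obtain ⟨h1, h2⟩ := D.c_endpoints n n' 1 (by omega) i j q hpq hc
        rw [idem_smul, ract_ract, ← ract_lact, lact_ε, ← map_mul, (D.uniform 1 q).mul_vertex,
          if_pos h1.symm, if_pos h2]
    · rw [ract_f_ε _ _ _ _ hpq, smul_zero]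

end ComultResolution
end PathAlgebra

end

/-! Zero is a homotopy lifting because both commutators `(η ⊗ 1 - 1 ⊗ η) Δ` and `(μ ⊗ 1 - 1 ⊗ μ) Δ`
vanish identically; then `φ = 0` and `ξ = 0` settle the second condition.

For `μ` this is counitality of `Δ`: the `f^0_p` sum to `1`, so the coefficients `c_{pq}(m,i,0)` and
`c_{pq}(m,i,m)` of composable pairs are Kronecker deltas (`commutatorMap_μ`).

For `η`, the value `e_j` forces `f^n_i` to start and end at `j`, and the commutator at `ε^m_a`
compares the coefficient of `f^n_i f^l_q` in `f^m_a` with that of `f^l_q f^n_i`. They have to agree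
up to the sign `(-1)^{nl}` (`composableCoeff_comm`). For `l = 1` this is the cocycle condition: `η
d` sends `ε^{n+1}_a` to a combination of arrows, and arrows stay independent modulo `I ⊆ J²`
(`composableCoeff_of_isCocycle`). Induction on `l` gives the rest: split an arrow off `f^l_q` and
move `f^n_i` past the two factors in turn. This needs the coefficients to be coassociative
(`composableCoeff_coassoc`), which follows from directness of the sums `⨁ f^r_p kQ`. Coefficients of
non-composable pairs are arbitrary, so they are set to zero throughout. -/

namespace PathAlgebra

variable {k : Type u} {V : Type v} [Quiver.{w} V] [Field k]

/-! ### Coefficients of paths -/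

theorem coeff_finsetSum {ι : Type*} (S : Finset ι) (g : ι → PathAlgebra k V) (q : QPath V) :
    coeff (∑ i ∈ S, g i) q = ∑ i ∈ S, coeff (g i) q := by
  simp [coeff, Finsupp.finsetSum_apply]

theorem coeff_smul (c : k) (x : PathAlgebra k V) (q : QPath V) :
    coeff (c • x) q = c * coeff x q := by
  simp [coeff]

theorem coeff_ofPath_of_ne {p q : QPath V} (h : p ≠ q) : coeff (ofPath k p) q = 0 := by
  simp [coeff, ofPath, h]

theorem coeff_ofPath_self (p : QPath V) : coeff (ofPath k p) p = 1 := by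
  simp [coeff, ofPath]

variable [Fintype V] {I : Ideal (PathAlgebra k V)}

/-- A trivial path has length `0 < 2`. This keeps the value `e_j` of `η` nonzero in `Λ`. -/
theorem IsContainedInSquare.vertex_notMem (h : IsContainedInSquare I) (a : V) :
    vertex k a ∉ I := fun ha => by
  have := h _ ha ⟨a, a, .nil⟩ (by rw [vertex, coeff_ofPath_self]; exact one_ne_zero)
  simp at this

namespace ComultResolution

variable [I.IsTwoSided] (D : ComultResolution I)

/-! ### Normalised structure coefficients and their coassociativity -/

open Classical in
/-- The coefficient `c_{pq}(n,i,r)` if `f^r_p` and `f^s_q` are composable, and `0` otherwise. -/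
noncomputable def composableCoeff (n r s : ℕ) (i : Fin (D.t n)) (p : Fin (D.t r)) (q : Fin (D.t s)) : k :=
  if D.term r p = D.orig s q then D.c n r s i p q else 0

/-- The terminus idempotent of `f^r_p` can be inserted between the factors, and it kills `f^s_q`.
Hence the comultiplicative equation says nothing about `c` on such pairs, and replacing it by `0`
there is harmless. -/
theorem f_mul_f_of_ne {r s : ℕ} {p : Fin (D.t r)} {q : Fin (D.t s)}
    (h : D.term r p ≠ D.orig s q) : D.f r p * D.f s q = 0 := by
  classical
  have h1 := (D.uniform r p).mul_vertex (D.term r p)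
  rw [if_pos rfl] at h1
  rw [← h1, mul_assoc, (D.uniform s q).vertex_mul, if_neg h, mul_zero]

theorem composableCoeff_smul (n r s : ℕ) (i p q) :
    D.composableCoeff n r s i p q • (D.f r p * D.f s q) =
      D.c n r s i p q • (D.f r p * D.f s q) := by
  rw [composableCoeff]
  split_ifs with h
  · rfl
  · rw [D.f_mul_f_of_ne h, smul_zero, smul_zero]

/-- Unlike those in `comult`, these coefficients are uniquely determined, by `coeff_eq_zero`. -/
theorem f_eq_sum (n r s : ℕ) (hn : r + s = n) (i : Fin (D.t n)) :
    D.f n i = ∑ p, ∑ q, D.composableCoeff n r s i p q • (D.f r p * D.f s q) := by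
  simp_rw [composableCoeff_smul]
  exact D.comult n r s hn i

theorem composableCoeff_of_ne {n r s : ℕ} {i : Fin (D.t n)} {p : Fin (D.t r)} {q : Fin (D.t s)}
    (h : D.term r p ≠ D.orig s q) : D.composableCoeff n r s i p q = 0 := if_neg h

theorem composableCoeff_ne_zero {n r s : ℕ} (hn : r + s = n) {i : Fin (D.t n)} {p : Fin (D.t r)}
    {q : Fin (D.t s)} (h : D.composableCoeff n r s i p q ≠ 0) :
    D.term r p = D.orig s q ∧ D.orig r p = D.orig n i ∧ D.term s q = D.term n i := by
  by_cases hpq : D.term r p = D.orig s q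
  · rw [composableCoeff, if_pos hpq] at h
    exact ⟨hpq, D.c_endpoints n r s hn i p q hpq h⟩
  · exact absurd (D.composableCoeff_of_ne hpq) h

/-- The products `f^r_p f^s_q f^t_u` of composable triples are linearly independent. -/
theorem coeff_eq_zero_of_sum_mul_mul (r s t : ℕ) (b : Fin (D.t r) → Fin (D.t s) → Fin (D.t t) → k)
    (h : ∑ p, ∑ q, ∑ u, b p q u • (D.f r p * (D.f s q * D.f t u)) = 0) (p q u)
    (hpq : D.term r p = D.orig s q) (hqu : D.term s q = D.orig t u) : b p q u = 0 := by
  classical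
  have h1 := D.eq_zero_of_sum_mul r (fun p => ∑ q, ∑ u, b p q u • (D.f s q * D.f t u))
    (by simpa [Finset.mul_sum] using h) p
  -- Cancelling the uniform element `f^r_p` leaves its terminus idempotent, which selects the `q`
  -- composable with `p`; this reduces triples to pairs.
  have h2 : ∑ q, ∑ u, (if D.term r p = D.orig s q then b p q u else 0) •
      (D.f s q * D.f t u) = 0 := by
    rw [← h1, Finset.mul_sum]
    refine Finset.sum_congr rfl fun q _ => ?_
    rw [Finset.mul_sum]
    refine Finset.sum_congr rfl fun u _ => ?_
    rw [mul_smul_comm, ← mul_assoc, (D.uniform s q).vertex_mul]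
    split_ifs <;> simp
  simpa [hpq] using D.coeff_eq_zero s t _ h2 q u hqu

/-- Coassociativity of the comultiplicative structure. -/
theorem composableCoeff_coassoc {m r s t rs st : ℕ} (hrs : r + s = rs) (hst : s + t = st)
    (hm : r + st = m) (i : Fin (D.t m)) (p : Fin (D.t r)) (q : Fin (D.t s)) (u : Fin (D.t t)) :
    ∑ b, D.composableCoeff m r st i p b * D.composableCoeff st s t b q u =
      ∑ b, D.composableCoeff m rs t i b u * D.composableCoeff rs r s b p q := by
  -- If the triple is not composable, both sums vanish termwise: a nonzero coefficient forces its
  -- end points to match, so a nonzero product of two would make the triple composable.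
  by_cases hpq : D.term r p = D.orig s q
  swap
  · rw [Finset.sum_eq_zero, Finset.sum_eq_zero]
    · intro b _
      rw [D.composableCoeff_of_ne hpq, mul_zero]
    · intro b _
      by_contra h
      have h1 := D.composableCoeff_ne_zero hm (left_ne_zero_of_mul h)
      have h2 := D.composableCoeff_ne_zero hst (right_ne_zero_of_mul h)
      exact hpq (h1.1.trans h2.2.1.symm)
  by_cases hqu : D.term s q = D.orig t u
  swap
  · rw [Finset.sum_eq_zero, Finset.sum_eq_zero]
    · intro b _
      by_contra h
      have h1 := D.composableCoeff_ne_zero (by omega) (left_ne_zero_of_mul h)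
      have h2 := D.composableCoeff_ne_zero hrs (right_ne_zero_of_mul h)
      exact hqu (h2.2.2.trans h1.1)
    · intro b _
      rw [D.composableCoeff_of_ne hqu, mul_zero]
  -- `f^m_i` is expanded into triple products in two ways, splitting the right factor here and the
  -- left factor in `hr`; independence of the composable triples identifies the coefficients.
  have hl : D.f m i = ∑ p, ∑ q, ∑ u,
      (∑ b, D.composableCoeff m r st i p b * D.composableCoeff st s t b q u) •
        (D.f r p * (D.f s q * D.f t u)) := by
    rw [D.f_eq_sum m r st hm i]
    refine Finset.sum_congr rfl fun p _ => ?_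
    have h (b : Fin (D.t st)) : D.composableCoeff m r st i p b • (D.f r p * D.f st b) =
        ∑ q, ∑ u, (D.composableCoeff m r st i p b * D.composableCoeff st s t b q u) •
          (D.f r p * (D.f s q * D.f t u)) := by
      conv_lhs => rw [D.f_eq_sum st s t hst b]
      simp_rw [Finset.mul_sum, Finset.smul_sum, mul_smul_comm, smul_smul]
    simp_rw [h, Finset.sum_smul]
    rw [Finset.sum_comm]
    exact Finset.sum_congr rfl fun q _ => Finset.sum_comm
  have hr : D.f m i = ∑ p, ∑ q, ∑ u,
      (∑ b, D.composableCoeff m rs t i b u * D.composableCoeff rs r s b p q) •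
        (D.f r p * (D.f s q * D.f t u)) := by
    rw [D.f_eq_sum m rs t (by omega) i]
    have h (b : Fin (D.t rs)) (u) : D.composableCoeff m rs t i b u • (D.f rs b * D.f t u) =
        ∑ p, ∑ q, (D.composableCoeff m rs t i b u * D.composableCoeff rs r s b p q) •
          (D.f r p * (D.f s q * D.f t u)) := by
      conv_lhs => rw [D.f_eq_sum rs r s hrs b]
      simp_rw [Finset.sum_mul, Finset.smul_sum, smul_mul_assoc, smul_smul, mul_assoc]
    simp_rw [h, Finset.sum_smul]
    rw [Finset.sum_comm' (t' := Finset.univ) (s' := fun _ => Finset.univ) (by simp)]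
    calc _ = ∑ u, ∑ p, ∑ q, ∑ b,
          (D.composableCoeff m rs t i b u * D.composableCoeff rs r s b p q) •
            (D.f r p * (D.f s q * D.f t u)) := by
          refine Finset.sum_congr rfl fun u _ => ?_
          rw [Finset.sum_comm]
          exact Finset.sum_congr rfl fun p _ => Finset.sum_comm
      _ = _ := by
          rw [Finset.sum_comm]
          exact Finset.sum_congr rfl fun p _ => Finset.sum_comm
  refine sub_eq_zero.1 (D.coeff_eq_zero_of_sum_mul_mul r s t (fun p q u =>
    ∑ b, D.composableCoeff m r st i p b * D.composableCoeff st s t b q u -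
      ∑ b, D.composableCoeff m rs t i b u * D.composableCoeff rs r s b p q) ?_ p q u hpq hqu)
  simp_rw [sub_smul, Finset.sum_sub_distrib]
  rw [← hl, ← hr, sub_self]

/-! ### Degree zero and the counit -/

theorem sum_f_zero : ∑ p, D.f 0 p = 1 := by
  simp_rw [D.f_zero]
  exact Equiv.sum_comp D.vertexEquiv (vertex k)

/-- Since `∑ f^0_p = 1`, the identity `f^m_i = ∑ f^0_p f^m_i` is a second expansion of `f^m_i`, with
Kronecker coefficients. Composable products are independent, so the two expansions agree on them. -/
theorem c_zero_left (m : ℕ) (i q : Fin (D.t m)) (p : Fin (D.t 0))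
    (h : D.term 0 p = D.orig m q) : D.c m 0 m i p q = if q = i then 1 else 0 := by
  refine sub_eq_zero.1
    (D.coeff_eq_zero 0 m (fun p q => D.c m 0 m i p q - if q = i then 1 else 0) ?_ p q h)
  simp_rw [sub_smul, Finset.sum_sub_distrib]
  rw [← D.comult m 0 m (Nat.zero_add m) i]
  simp [← Finset.sum_mul, D.sum_f_zero]

theorem c_zero_right (m : ℕ) (i p : Fin (D.t m)) (q : Fin (D.t 0))
    (h : D.term m p = D.orig 0 q) : D.c m m 0 i p q = if p = i then 1 else 0 := by
  refine sub_eq_zero.1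
    (D.coeff_eq_zero m 0 (fun p q => D.c m m 0 i p q - if p = i then 1 else 0) ?_ p q h)
  simp_rw [sub_smul, Finset.sum_sub_distrib]
  rw [← D.comult m m 0 (Nat.add_zero m) i]
  simp [← Finset.mul_sum, D.sum_f_zero]

/-- The trivial path occurs in `f^0_p`, and uniformity makes its two equal end points the recorded
origin and terminus. -/
theorem orig_eq_term_zero (p : Fin (D.t 0)) : D.orig 0 p = D.term 0 p := by
  obtain ⟨-, l, hl⟩ := D.uniform 0 p
  have := hl ⟨_, _, .nil⟩ (by rw [D.f_zero, vertex, coeff_ofPath_self]; exact one_ne_zero)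
  exact this.1.symm.trans this.2.1

theorem μ_ε (p : Fin (D.t 0)) : D.μ (D.ε 0 p) = Ideal.Quotient.mk I (D.f 0 p) := by
  classical
  rw [μ, lift_ε, idem, env_smul_self, ← map_mul, ← map_mul, (D.uniform 0 p).vertex_mul,
    if_pos rfl, (D.uniform 0 p).mul_vertex, if_pos rfl]

theorem evalLeft_Δ_ε {m n l : ℕ} (hm : n + l = m)
    (η : D.K n →ₗ[Env k (PathAlgebra k V ⧸ I)] (PathAlgebra k V ⧸ I)) (i : Fin (D.t m)) :
    evalLeft (D.K l) η (D.Δ m n l (D.ε m i)) =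
      ∑ p, ∑ q, D.c m n l i p q • lact k (η (D.ε n p)) (D.ε l q) := by
  simp_rw [D.Δ_ε m n l hm, ΔValue, map_sum, LinearMap.map_smul_of_tower, evalLeft_btmul]

theorem evalRight_Δ_ε {m n l : ℕ} (hm : l + n = m)
    (η : D.K n →ₗ[Env k (PathAlgebra k V ⧸ I)] (PathAlgebra k V ⧸ I)) (i : Fin (D.t m)) :
    evalRight (D.K l) η (D.Δ m l n (D.ε m i)) =
      ∑ p, ∑ q, D.c m l n i p q • ract k (D.ε l p) (η (D.ε n q)) := by
  simp_rw [D.Δ_ε m l n hm, ΔValue, map_sum, LinearMap.map_smul_of_tower, evalRight_btmul]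

/-- The element is the value of `μ ⊗ 1` at `ε^0_p ⊗ ε^m_q`, a tensor that is zero because its inner
end points differ. -/
theorem lact_f_zero_ε_of_ne {m : ℕ} {p : Fin (D.t 0)} {q : Fin (D.t m)}
    (h : D.term 0 p ≠ D.orig m q) : lact k (Ideal.Quotient.mk I (D.f 0 p)) (D.ε m q) = 0 := by
  rw [← D.μ_ε, ← evalLeft_btmul, D.btmul_eq_zero _ _ _ _ h, map_zero]

theorem ract_f_zero_ε_of_ne {m : ℕ} {p : Fin (D.t 0)} {q : Fin (D.t m)}
    (h : D.term m q ≠ D.orig 0 p) : ract k (D.ε m q) (Ideal.Quotient.mk I (D.f 0 p)) = 0 := by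
  rw [← D.μ_ε, ← evalRight_btmul, D.btmul_eq_zero _ _ _ _ h, map_zero]

/-- `Δ` is counital on both sides, so that `(μ ⊗ 1 - 1 ⊗ μ) Δ = 0`. -/
theorem commutatorMap_μ (m : ℕ) : commutatorMap D.Δ D.μ m m = 0 := by
  refine D.hom_ext m _ _ fun i => ?_
  rw [commutatorMap, LinearMap.sub_apply, LinearMap.smul_apply, LinearMap.comp_apply,
    LinearMap.comp_apply, D.evalLeft_Δ_ε (Nat.zero_add m), D.evalRight_Δ_ε (Nat.add_zero m),
    Nat.zero_mul, pow_zero, one_smul, LinearMap.zero_apply, sub_eq_zero]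
  have hone : Ideal.Quotient.mk I (∑ p, D.f 0 p) = 1 := by rw [D.sum_f_zero, map_one]
  -- Both `(μ ⊗ 1) Δ` and `(1 ⊗ μ) Δ` fix `ε^m_i`.
  trans D.ε m i
  -- For composable pairs `c` is a Kronecker delta; for the others the vertex acts by zero, so the
  -- arbitrary value of `c` does not matter.
  · have h (p q) : D.c m 0 m i p q • lact k (D.μ (D.ε 0 p)) (D.ε m q) =
        if q = i then lact k (D.μ (D.ε 0 p)) (D.ε m i) else 0 := by
      rw [D.μ_ε]
      by_cases hpq : D.term 0 p = D.orig m q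
      · rw [D.c_zero_left m i q p hpq]
        split_ifs with hq
        · rw [one_smul, hq]
        · rw [zero_smul]
      · rw [D.lact_f_zero_ε_of_ne hpq, smul_zero]
        split_ifs with hq
        · rw [← hq, D.lact_f_zero_ε_of_ne hpq]
        · rfl
    simp_rw [h, Finset.sum_ite_eq', Finset.mem_univ, if_true, D.μ_ε]
    -- The remaining sum over `p` is the action of `∑ f^0_p = 1`.
    have hs := map_sum (envLeft k (A := PathAlgebra k V ⧸ I))
      (fun p => Ideal.Quotient.mk I (D.f 0 p)) Finset.univ
    rw [← map_sum, hone, map_one] at hs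
    calc _ = (∑ p, envLeft k (Ideal.Quotient.mk I (D.f 0 p))) • D.ε m i :=
          (Finset.sum_smul).symm
      _ = _ := by rw [← hs, one_smul]
  · symm
    have h (p q) : D.c m m 0 i p q • ract k (D.ε m p) (D.μ (D.ε 0 q)) =
        if p = i then ract k (D.ε m i) (D.μ (D.ε 0 q)) else 0 := by
      rw [D.μ_ε]
      by_cases hpq : D.term m p = D.orig 0 q
      · rw [D.c_zero_right m i p q hpq]
        split_ifs with hq
        · rw [one_smul, hq]
        · rw [zero_smul]
      · rw [D.ract_f_zero_ε_of_ne hpq, smul_zero]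
        split_ifs with hq
        · rw [← hq, D.ract_f_zero_ε_of_ne hpq]
        · rfl
    rw [Finset.sum_comm]
    simp_rw [h, Finset.sum_ite_eq', Finset.mem_univ, if_true, D.μ_ε]
    have hs := map_sum (envRight k (A := PathAlgebra k V ⧸ I))
      (fun p => op (Ideal.Quotient.mk I (D.f 0 p))) Finset.univ
    rw [← Finset.op_sum, ← map_sum, hone, op_one, map_one] at hs
    calc _ = (∑ p, envRight k (op (Ideal.Quotient.mk I (D.f 0 p)))) • D.ε m i :=
          (Finset.sum_smul).symm
      _ = _ := by rw [← hs, one_smul]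

/-! ### Cocycles with a single nonzero value `e_j` -/

/-- The arrows are linearly independent in `Λ = kQ/I`, as `I ⊆ J²`. -/
theorem eq_zero_of_mk_sum_arrows (hsquare : IsContainedInSquare I) (b : Fin (D.t 1) → k)
    (h : Ideal.Quotient.mk I (∑ p, b p • D.f 1 p) = 0) (p : Fin (D.t 1)) : b p = 0 := by
  refine D.linearIndependent 1 b (ext_coeff fun q => ?_) p
  rw [show coeff (0 : PathAlgebra k V) q = 0 by simp [coeff]]
  by_contra hq
  -- A path occurring in this element of `I` has length at least two, yet it must be one of the
  -- arrows.
  have hlen := hsquare _ (Ideal.Quotient.eq_zero_iff_mem.1 h) q hq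
  rw [coeff_finsetSum] at hq
  obtain ⟨p, -, hp⟩ := Finset.exists_ne_zero_of_sum_ne_zero hq
  rw [coeff_smul, D.f_one, arrow] at hp
  have : (⟨_, _, (D.arrowEquiv p).2.2.toPath⟩ : QPath V) = q :=
    of_not_not fun hne => hp (by rw [coeff_ofPath_of_ne hne, mul_zero])
  rw [← this] at hlen
  simp at hlen

section VertexCocycle

variable {n : ℕ} {η : D.K n →ₗ[Env k (PathAlgebra k V ⧸ I)] (PathAlgebra k V ⧸ I)}
  {i : Fin (D.t n)} {j : V}

/-- `η` is left linear and the origin idempotent fixes `ε^n_i`, so it must also fix `e_j`. Otherwise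
the product of two distinct vertices would give `e_j = 0` in `Λ`. -/
theorem orig_eq_of_map_ε (hsquare : IsContainedInSquare I)
    (hi : η (D.ε n i) = Ideal.Quotient.mk I (vertex k j)) : D.orig n i = j := by
  classical
  by_contra hne
  have h := map_lact η (Ideal.Quotient.mk I (vertex k (D.orig n i))) (D.ε n i)
  rw [lact_ε, if_pos rfl, hi, lact_self, ← map_mul, mk_vertex_mul_vertex, if_neg hne, map_zero] at h
  exact hsquare.vertex_notMem j (Ideal.Quotient.eq_zero_iff_mem.1 h)

theorem term_eq_of_map_ε (hsquare : IsContainedInSquare I)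
    (hi : η (D.ε n i) = Ideal.Quotient.mk I (vertex k j)) : D.term n i = j := by
  classical
  by_contra hne
  have h := map_ract η (Ideal.Quotient.mk I (vertex k (D.term n i))) (D.ε n i)
  rw [ract_ε, if_pos rfl, hi, ract_self, ← map_mul, mk_vertex_mul_vertex, if_neg (Ne.symm hne),
    map_zero] at h
  exact hsquare.vertex_notMem j (Ideal.Quotient.eq_zero_iff_mem.1 h)

/-- The cocycle condition, in terms of coefficients. -/
theorem composableCoeff_of_isCocycle (hsquare : IsContainedInSquare I) (hη : IsCocycle D.d η)
    (hi : η (D.ε n i) = Ideal.Quotient.mk I (vertex k j)) (h0 : ∀ r, r ≠ i → η (D.ε n r) = 0)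
    (a : Fin (D.t (n + 1))) (s : Fin (D.t 1)) :
    D.composableCoeff (n + 1) n 1 a i s =
      (-1) ^ n * D.composableCoeff (n + 1) 1 n a s i := by
  classical
  have hj := D.orig_eq_of_map_ε hsquare hi
  have hj' := D.term_eq_of_map_ε hsquare hi
  have h := LinearMap.congr_fun hη (D.ε (n + 1) a)
  rw [LinearMap.comp_apply, D.d_ε (n + 1) n rfl, dValue, map_sum, LinearMap.zero_apply,
    Finset.sum_eq_single i] at h
  -- Only the summand at `ε^n_i` survives `η`. Multiplying an arrow by `e_j` keeps it exactly when
  -- it is composable with `f^n_i`, which turns `c` into `composableCoeff`.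
  · have hsum : Ideal.Quotient.mk I (∑ s, (D.composableCoeff (n + 1) 1 n a s i +
        (-1) ^ (n + 1) * D.composableCoeff (n + 1) n 1 a i s) • D.f 1 s) = 0 := by
      rw [← h, map_add, map_zsmul, map_sum, map_sum, map_sum]
      simp_rw [LinearMap.map_smul_of_tower, map_lact, map_ract, hi, lact_self, ract_self,
        ← map_mul]
      rw [Finset.smul_sum, ← Finset.sum_add_distrib]
      refine Finset.sum_congr rfl fun s _ => ?_
      rw [(D.uniform 1 s).mul_vertex, (D.uniform 1 s).vertex_mul, composableCoeff,
        composableCoeff, hj, hj']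
      have e (c : k) (x : PathAlgebra k V) :
          Ideal.Quotient.mk I (c • x) = c • Ideal.Quotient.mk I x := rfl
      rw [e, add_smul, mul_smul]
      congr 1
      · split_ifs <;> simp
      · rcases neg_one_pow_eq_or ℤ (n + 1) with h1 | h1 <;>
        rcases Nat.even_or_odd (n + 1) with h2 | h2 <;>
        split_ifs <;> simp_all [h2.neg_one_pow]
    have := D.eq_zero_of_mk_sum_arrows hsquare _ hsum s
    rw [pow_succ] at this
    have h1 : ((-1 : k) ^ n) * (-1) ^ n = 1 := by rw [← mul_pow]; simp
    linear_combination (-(-1 : k) ^ n) * this - D.composableCoeff (n + 1) n 1 a i s * h1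
  · intro r _ hr
    simp_rw [map_add, map_zsmul, map_sum, LinearMap.map_smul_of_tower, map_lact, map_ract, h0 r hr,
      lact_zero, zero_ract, smul_zero, Finset.sum_const_zero, smul_zero, add_zero]
  · simp

/-- Inside every `f^m_a`, the factor `f^n_i` commutes with `f^l_q` up to the Koszul sign. The
cocycle condition is the case `l = 1`; since each `f^{l+1}_q` is a combination of products `f^1_s
f^l_u`, coassociativity propagates it to all `l`. -/
theorem composableCoeff_comm (hsquare : IsContainedInSquare I) (hη : IsCocycle D.d η)
    (hi : η (D.ε n i) = Ideal.Quotient.mk I (vertex k j)) (h0 : ∀ r, r ≠ i → η (D.ε n r) = 0)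
    {m l : ℕ} (hm : n + l = m) (a : Fin (D.t m)) (q : Fin (D.t l)) :
    D.composableCoeff m n l a i q = (-1) ^ (n * l) * D.composableCoeff m l n a q i := by
  classical
  -- `m` and `a` must vary: the induction hypothesis is applied to elements of degree `n + l`, not
  -- to `f^m_a` itself.
  induction l generalizing m with
  | zero =>
    subst hm
    have h1 := D.orig_eq_of_map_ε hsquare hi
    have h2 := D.term_eq_of_map_ε hsquare hi
    have h3 := D.orig_eq_term_zero q
    simp only [Nat.add_zero] at a ⊢
    rw [composableCoeff, composableCoeff, mul_zero, pow_zero, one_mul]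
    -- As `f^n_i` starts and ends at `j`, a vertex is composable with it on both sides or on
    -- neither; in the first case both coefficients are the same Kronecker delta.
    by_cases h : D.term n i = D.orig 0 q
    · have h' : D.term 0 q = D.orig n i := by rw [← h3, ← h, h1, h2]
      rw [if_pos h, if_pos h', D.c_zero_right n a i q h, D.c_zero_left n a i q h']
    · have h' : D.term 0 q ≠ D.orig n i := fun h' => h (by rw [h3, h', h1, h2])
      rw [if_neg h, if_neg h']
  | succ l ih =>
    -- Writing `i`, `s`, `u` for the three factors, the chain is `i(su) = (is)u`, then `(si)u` with
    -- sign `(-1)^n`, then `s(iu)`, then `s(ui) = (su)i` with sign `(-1)^{nl}`.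
    have key (s : Fin (D.t 1)) (u : Fin (D.t l)) :
        ∑ b, D.composableCoeff m n (l + 1) a i b * D.composableCoeff (l + 1) 1 l b s u =
          (-1) ^ (n * (l + 1)) *
            ∑ b, D.composableCoeff m (l + 1) n a b i * D.composableCoeff (l + 1) 1 l b s u := by
      rw [D.composableCoeff_coassoc (rs := n + 1) rfl (Nat.add_comm 1 l) hm,
        ← D.composableCoeff_coassoc (st := n + l) (Nat.add_comm 1 l) (Nat.add_comm l n) (by omega)]
      simp_rw [D.composableCoeff_of_isCocycle hsquare hη hi h0, mul_left_comm _ ((-1 : k) ^ n)]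
      rw [← Finset.mul_sum, ← D.composableCoeff_coassoc (Nat.add_comm 1 n) rfl (by omega)]
      simp_rw [ih rfl, mul_left_comm _ ((-1 : k) ^ (n * l))]
      rw [← Finset.mul_sum, ← mul_assoc, ← pow_add, mul_add, mul_one, add_comm]
    -- To recover a single `q` from `key`, the differences are taken as coefficients of the
    -- independent `f^{l+1}_q`; after splitting each of these into `f^1_s f^l_u`, every coefficient
    -- vanishes by `key`.
    refine sub_eq_zero.1 (D.linearIndependent (l + 1) (fun q => D.composableCoeff m n (l + 1) a i q -
      (-1) ^ (n * (l + 1)) * D.composableCoeff m (l + 1) n a q i) ?_ q)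
    simp_rw [D.f_eq_sum (l + 1) 1 l (Nat.add_comm 1 l), Finset.smul_sum, smul_smul]
    rw [Finset.sum_comm]
    refine Finset.sum_eq_zero fun s _ => ?_
    rw [Finset.sum_comm]
    refine Finset.sum_eq_zero fun u _ => ?_
    simp_rw [← Finset.sum_smul, sub_mul, Finset.sum_sub_distrib, key s u, mul_assoc,
      ← Finset.mul_sum, sub_self, zero_smul]

/-- Acting by `e_j` on `ε^l_q` gives `ε^l_q` or `0` according to composability with `f^n_i`. So the
two halves of the commutator read off the coefficients compared in `composableCoeff_comm`. -/
theorem commutatorMap_eq_zero (hsquare : IsContainedInSquare I) (hη : IsCocycle D.d η)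
    (hi : η (D.ε n i) = Ideal.Quotient.mk I (vertex k j)) (h0 : ∀ r, r ≠ i → η (D.ε n r) = 0)
    {m l : ℕ} (hm : m = n + l) : commutatorMap D.Δ η m l = 0 := by
  classical
  have hj := D.orig_eq_of_map_ε hsquare hi
  have hj' := D.term_eq_of_map_ε hsquare hi
  refine D.hom_ext m _ _ fun a => ?_
  have hl : evalLeft (D.K l) η (D.Δ m n l (D.ε m a)) =
      ∑ q, D.composableCoeff m n l a i q • D.ε l q := by
    rw [D.evalLeft_Δ_ε hm.symm, Finset.sum_eq_single i]
    · refine Finset.sum_congr rfl fun q _ => ?_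
      rw [hi, lact_ε, composableCoeff, hj']
      split_ifs <;> simp
    · intro r _ hr
      simp_rw [h0 r hr, zero_lact, smul_zero, Finset.sum_const_zero]
    · simp
  have hr : evalRight (D.K l) η (D.Δ m l n (D.ε m a)) =
      ∑ q, D.composableCoeff m l n a q i • D.ε l q := by
    rw [D.evalRight_Δ_ε (by omega)]
    refine Finset.sum_congr rfl fun q _ => ?_
    rw [Finset.sum_eq_single i]
    · rw [hi, ract_ε, composableCoeff, hj]
      split_ifs <;> simp
    · intro r _ hr
      rw [h0 r hr, ract_zero, smul_zero]
    · simp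
  rw [commutatorMap, LinearMap.sub_apply, LinearMap.smul_apply, LinearMap.comp_apply,
    LinearMap.comp_apply, hl, hr, LinearMap.zero_apply, sub_eq_zero, Finset.smul_sum]
  refine Finset.sum_congr rfl fun q _ => ?_
  rw [D.composableCoeff_comm hsquare hη hi h0 hm.symm, mul_smul]
  -- The sign is a scalar of `k` on one side and an integer on the other; parity reconciles them.
  rcases Nat.even_or_odd (n * l) with h | h <;> simp [h.neg_one_pow]

end VertexCocycle

end ComultResolution
end PathAlgebra

theorem mainTheorem2 {k : Type u} [Field k] {V : Type v} [Fintype V] [Quiver.{w} V]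
    (I : Ideal (PathAlgebra k V)) [I.IsTwoSided]
    (hgraded : PathAlgebra.IsGradedIdeal I) (hsquare : PathAlgebra.IsContainedInSquare I)
    (hKoszul : PathAlgebra.IsKoszul I)
    (D : PathAlgebra.ComultResolution I) (n : ℕ)
    (η : D.K n →ₗ[Env k (PathAlgebra k V ⧸ I)] (PathAlgebra k V ⧸ I))
    (hη : IsCocycle D.d η) (i : Fin (D.t n)) (j : V)
    (hi : η (D.ε n i) = Ideal.Quotient.mk I (PathAlgebra.vertex k j))
    (h0 : ∀ r, r ≠ i → η (D.ε n r) = 0) :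
    IsHomotopyLifting D.d D.μ D.Δ η (fun _ _ => 0) := by
  -- Strict counitality of `Δ` allows `φ = 0`; then `μ ψ` and `η φ` are both zero, and `ξ = 0`
  -- witnesses that they are cohomologous.
  refine ⟨fun m l hm => ?_, fun _ _ => 0, fun m => ?_, fun m _ => ⟨0, ?_⟩⟩
  · rw [D.commutatorMap_eq_zero hsquare hη hi h0 hm]
    simp
  · rw [D.commutatorMap_μ]
    simp
  · simp
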